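/- For $p,q\in\mathbb{C}$ and $\tau$ in the upper half-plane $\mathbb{H}$ let $$\vartheta[p,q](\tau)=\sum_{m\in\mathbb{Z}}\exp\bigl(\pi i(m+p)^2\tau+2\pi i(m+p)q\bigr),$$ and let $\partial_q\vartheta[p,q](\tau)$ be its partial derivative in $q$. Let the permutations $\tilde S(p,q)=(-q,p)$ and $\tilde T(p,q)=(p,q+p+\tfrac12)$ act on $(\mathbb{R}/\mathbb{Z})^2$, identified with $[0,1)^2$, and for real $p,q$ let $\mathcal{O}_{(p,q)}\subset[0,1)^2$ be the orbit of $(p,q)$ under the group generated by $\tilde S$ and $\tilde T$. Suppose that $\mathcal{O}_{(p,q)}$ is finite, with $n$ elements, and that $\mathcal{O}_{(p,q)}\neq\{(\frac12,\frac12)\}$ and $\mathcal{O}_{(p,q)}\neq\{(0,0),(\frac12,0),(0,\frac12)\}$. Let $n_0$ be the number of points $(p',q')\in\mathcal{O}_{(p,q)}$ with $p'=0$. Then $n$ is even. Moreover, for every $(p',q')\in\mathcal{O}_{(p,q)}$ the function $\tau\mapsto\partial_q\vartheta[p',q'](\tau)$ is holomorphic on $\mathbb{H}$ and does not vanish identically.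 Let $v_\tau[p',q']$ denote its order of vanishing at $\tau\in\mathbb{H}$, let $\rho=e^{2\pi i/3}$, and let $R\subset\mathbb{H}$ be any set that contains exactly one point of each $PSL_2(\mathbb{Z})$-orbit on $\mathbb{H}$. Then each $\partial_q\vartheta[p',q']$ with $(p',q')\in\mathcal{O}_{(p,q)}$ has only finitely many zeros in $R$, and $$\sum_{(p',q')\in\mathcal{O}_{(p,q)}}\Bigl(\tfrac12 v_i[p',q']+\tfrac13 v_\rho[p',q']+\sum_{P\in R}{}^{\!*}\,v_P[p',q']\Bigr)=\frac{n}{12}-\frac{n_0}{2},$$ where the starred sum excludes the points of $R$ that are $PSL_2(\mathbb{Z})$-equivalent to $i$ or to $\rho$. -/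

import Mathlib

open scoped MatrixGroups

noncomputable section

namespace BianchiIX

/-- The theta function with characteristics `ϑ[p,q](z, τ)`, with `τ = iμ` in the upper half-plane:
`∑ₘ exp (π i (m + p)² τ + 2 π i (m + p) (z + q))`, the sum being over all integers `m`. -/
def thetaChar (p q z τ : ℂ) : ℂ :=
  ∑' m : ℤ, Complex.exp (Real.pi * Complex.I * (m + p) ^ 2 * τ
    + 2 * Real.pi * Complex.I * (m + p) * (z + q))

/-- The derivative `∂_q ϑ[p,q](τ)` of `ϑ[p,q](τ) = ϑ[p,q](0, τ)` in the characteristic `q`. -/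
def dqTheta (p q τ : ℂ) : ℂ :=
  deriv (fun q' : ℂ => thetaChar p q' 0 τ) q

/-- The torus `(ℝ/ℤ)²` of parameters `(p, q)`. -/
abbrev Param : Type := UnitAddCircle × UnitAddCircle

/-- The representative in `[0,1)` of a class modulo 1. -/
def rep (a : UnitAddCircle) : ℝ := (AddCircle.equivIco (1 : ℝ) 0 a : ℝ)

/-- The class of `1/2` modulo 1. -/
def half : UnitAddCircle := ((1 / 2 : ℝ) : UnitAddCircle)

/-- The permutation `(p, q) ↦ (-q, p)` of the parameters. -/
def permS : Equiv.Perm Param where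
  toFun x := (-x.2, x.1)
  invFun x := (x.2, -x.1)
  left_inv x := by simp
  right_inv x := by simp

/-- The permutation `(p, q) ↦ (p, q + p + 1/2)` of the parameters. -/
def permT : Equiv.Perm Param where
  toFun x := (x.1, x.2 + x.1 + half)
  invFun x := (x.1, x.2 - x.1 - half)
  left_inv x := Prod.ext rfl (by dsimp only; abel)
  right_inv x := Prod.ext rfl (by dsimp only; abel)

/-- The orbit of the parameter `x` under the group generated by the two permutations,
that is, under the action of the modular group on parameters. -/
def paramOrbit (x : Param) : Set Param :=
  MulAction.orbit (Subgroup.closure ({permS, permT} : Set (Equiv.Perm Param))) x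

/-- `∂_q ϑ[p',q']` as a function of `τ`, for `(p', q') ∈ [0,1)²` representing `x`. -/
def dqThetaAt (x : Param) (τ : ℂ) : ℂ := dqTheta (rep x.1) (rep x.2) τ

/-- The order of the zero of `∂_q ϑ[p',q']` at `τ` (it is `⊤` if the function vanishes
identically near `τ`). -/
def zeroOrder (x : Param) (τ : UpperHalfPlane) : ℕ∞ :=
  analyticOrderAt (dqThetaAt x) (τ : ℂ)

/-- `R` contains exactly one point of each orbit of the modular group on the upper half-plane. -/
def IsFundamentalSet (R : Set UpperHalfPlane) : Prop :=
  ∀ τ : UpperHalfPlane, ∃! P : UpperHalfPlane, P ∈ R ∧ P ∈ MulAction.orbit SL(2, ℤ) τ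

/-- The points of `R` equivalent neither to `i` nor to `ρ = exp (2 π i / 3)`. -/
def nonElliptic (R : Set UpperHalfPlane) : Set UpperHalfPlane :=
  {P | P ∈ R ∧ P ∉ MulAction.orbit SL(2, ℤ) UpperHalfPlane.I ∧
    P ∉ MulAction.orbit SL(2, ℤ) UpperHalfPlane.ρ}

end BianchiIX

end

/-!
Up to constants and the automorphy factor `τ ^ (3/2)`, the two generators of `SL₂(ℤ)` permute the
functions `∂_q ϑ[p,q]` as the given permutations permute the parameters. Hence the 48th power of the
product of these functions over an orbit of `n` elements is a modular form of level one and weight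
`72 n`, to which we apply the valence formula.

Its order at the cusp is read off from the leading terms of the theta series, which involve the
squares of the representatives of `p` in `(-1/2, 1/2]`; the sum of these squares over the orbit is
`n / 12`. Indeed, if `a + b + c ≡ 1/2` modulo `1` then in general
`(s(a) + s(b) + s(c)) ^ 2 = 1/4`, where `s` denotes this representative, and the mixed products
cancel over the orbit because of the symmetry `(p, q) ↦ (-q, p)`.

The valence formula holds for the functions `Δ ^ m * Q(j)`, with `Q` a polynomial, because `j` maps
`ℍ / SL₂(ℤ)` bijectively onto `ℂ` with ramification `2` at `i` and `3` at `ρ`: injectivity says that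
a lattice is determined by `g₂` and `g₃`, and the ramification follows from
`j' = -2πi E₄² E₆ / Δ`.
-/

noncomputable section

namespace BianchiIX

section ValenceFormula

open Filter Topology UpperHalfPlane ModularForm EisensteinSeries

/-! ### Lattices are determined by their invariants -/

section Weierstrass

open scoped PeriodPair

/-- A non-zero solution of order `n` at `0` would satisfy `n * A 0 = B 0`. -/
theorem eventually_eq_zero_of_euler_equation {d A B : ℂ → ℂ}
    (hd : AnalyticAt ℂ d 0) (hA : ContinuousAt A 0) (hB : ContinuousAt B 0)
    (hAB : ∀ m : ℕ, (m : ℂ) * A 0 ≠ B 0)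
    (h : ∀ᶠ z in 𝓝[≠] (0 : ℂ), z * deriv d z * A z = d z * B z) :
    ∀ᶠ z in 𝓝 (0 : ℂ), d z = 0 := by
  by_contra hne
  obtain ⟨n, g, hg, hg0, hdg⟩ := hd.exists_eventuallyEq_pow_smul_nonzero_iff.mpr hne
  simp only [sub_zero, smul_eq_mul] at hdg
  have hderiv : ∀ᶠ z in 𝓝 (0 : ℂ), z * deriv d z = z ^ n * (n * g z + z * deriv g z) := by
    filter_upwards [hdg.eventually_nhds, hg.eventually_analyticAt] with z hz hgz
    rw [EventuallyEq.deriv_eq hz, deriv_fun_mul (by fun_prop) hgz.differentiableAt]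
    rcases n with _ | n
    · simp
    · simp only [deriv_pow_field, Nat.add_sub_cancel]
      ring
  have heq : ∀ᶠ z in 𝓝[≠] (0 : ℂ), (n * g z + z * deriv g z) * A z = g z * B z := by
    filter_upwards [h, hderiv.filter_mono nhdsWithin_le_nhds, hdg.filter_mono nhdsWithin_le_nhds,
      self_mem_nhdsWithin] with z hz hz' hz'' hz0
    apply mul_left_cancel₀ (pow_ne_zero n hz0)
    rw [← mul_assoc, ← hz', hz, hz'', mul_assoc]
  have hleft : ContinuousAt (fun z ↦ (n * g z + z * deriv g z) * A z) 0 := by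
    have := hg.continuousAt
    have := hg.deriv.continuousAt
    fun_prop
  have hlim := tendsto_nhds_unique ((hleft.tendsto.mono_left nhdsWithin_le_nhds).congr' heq)
    ((hg.continuousAt.mul hB).tendsto.mono_left nhdsWithin_le_nhds)
  simp only [zero_mul, add_zero, Pi.mul_apply] at hlim
  exact hAB n (mul_left_cancel₀ hg0 (by linear_combination hlim))

theorem weierstrassP_eq_weierstrassPExcept_zero (L : PeriodPair) (z : ℂ) :
    L.weierstrassP z = L.weierstrassPExcept 0 z + 1 / z ^ 2 := by
  simpa using (L.weierstrassPExcept_add 0 z).symm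

theorem derivWeierstrassP_eq_derivWeierstrassPExcept_zero (L : PeriodPair) (z : ℂ) :
    L.derivWeierstrassP z = L.derivWeierstrassPExcept 0 z - 2 / z ^ 3 := by
  simpa using (L.derivWeierstrassPExcept_sub 0 z).symm

theorem eventually_deriv_weierstrassPExcept_zero (L : PeriodPair) :
    ∀ᶠ z in 𝓝[≠] (0 : ℂ), z ∉ L.lattice ∧ DifferentiableAt ℂ (L.weierstrassPExcept 0) z ∧
      deriv (L.weierstrassPExcept 0) z = L.derivWeierstrassPExcept 0 z := by
  filter_upwards [mem_nhdsWithin_of_mem_nhds (L.compl_lattice_sdiff_singleton_mem_nhds 0),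
    (L.analyticAt_weierstrassPExcept 0).eventually_analyticAt.filter_mono nhdsWithin_le_nhds,
    self_mem_nhdsWithin] with z hz ha hz0
  exact ⟨fun h ↦ hz ⟨h, by simpa using hz0⟩, ha.differentiableAt,
    L.eqOn_deriv_weierstrassPExcept_derivWeierstrassPExcept 0 hz⟩

/-- Subtracting the differential equations `℘'² = 4 ℘³ - g₂ ℘ - g₃` of the two lattices gives an
Euler equation at `0` for the difference of the regular parts of the two functions `℘`. -/
theorem weierstrassPExcept_zero_sub_euler_equation {L M : PeriodPair} (h₂ : L.g₂ = M.g₂)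
    (h₃ : L.g₃ = M.g₃) {z : ℂ} (hz : z ≠ 0) (hL : z ∉ L.lattice) (hM : z ∉ M.lattice) :
    z * (L.derivWeierstrassPExcept 0 z - M.derivWeierstrassPExcept 0 z) *
        (z ^ 3 * (L.derivWeierstrassPExcept 0 z + M.derivWeierstrassPExcept 0 z) - 4) =
      (L.weierstrassPExcept 0 z - M.weierstrassPExcept 0 z) *
        (4 * ((1 + z ^ 2 * L.weierstrassPExcept 0 z) ^ 2 +
          (1 + z ^ 2 * L.weierstrassPExcept 0 z) * (1 + z ^ 2 * M.weierstrassPExcept 0 z) +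
          (1 + z ^ 2 * M.weierstrassPExcept 0 z) ^ 2) - L.g₂ * z ^ 4) := by
  have hLz := L.derivWeierstrassP_sq z hL
  have hMz := M.derivWeierstrassP_sq z hM
  rw [← h₂, ← h₃] at hMz
  simp only [weierstrassP_eq_weierstrassPExcept_zero,
    derivWeierstrassP_eq_derivWeierstrassPExcept_zero] at hLz hMz
  have hsub := congrArg (z ^ 6 * ·) (congrArg₂ (· - ·) hLz hMz)
  field_simp at hsub
  apply mul_left_cancel₀ (pow_ne_zero 2 hz)
  linear_combination hsub

theorem eventually_weierstrassPExcept_zero_eq {L M : PeriodPair} (h₂ : L.g₂ = M.g₂)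
    (h₃ : L.g₃ = M.g₃) :
    ∀ᶠ z in 𝓝 (0 : ℂ), L.weierstrassPExcept 0 z - M.weierstrassPExcept 0 z = 0 := by
  have hLc := (L.analyticAt_weierstrassPExcept 0).continuousAt
  have hMc := (M.analyticAt_weierstrassPExcept 0).continuousAt
  have hLc' := (L.analyticAt_derivWeierstrassPExcept 0).continuousAt
  have hMc' := (M.analyticAt_derivWeierstrassPExcept 0).continuousAt
  refine eventually_eq_zero_of_euler_equation
    (A := fun z ↦ z ^ 3 * (L.derivWeierstrassPExcept 0 z + M.derivWeierstrassPExcept 0 z) - 4)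
    (B := fun z ↦ 4 * ((1 + z ^ 2 * L.weierstrassPExcept 0 z) ^ 2 +
      (1 + z ^ 2 * L.weierstrassPExcept 0 z) * (1 + z ^ 2 * M.weierstrassPExcept 0 z) +
      (1 + z ^ 2 * M.weierstrassPExcept 0 z) ^ 2) - L.g₂ * z ^ 4)
    ((L.analyticAt_weierstrassPExcept 0).sub (M.analyticAt_weierstrassPExcept 0))
    (by fun_prop) (by fun_prop) ?_ ?_
  · intro m hm
    norm_num at hm
    have : (m : ℂ) + 3 = 0 := by linear_combination -hm / 4
    norm_cast at this
  · filter_upwards [eventually_deriv_weierstrassPExcept_zero L,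
      eventually_deriv_weierstrassPExcept_zero M, self_mem_nhdsWithin]
      with z ⟨hzL, hdL, heL⟩ ⟨hzM, hdM, heM⟩ hz
    rw [deriv_fun_sub hdL hdM, heL, heM]
    exact weierstrassPExcept_zero_sub_euler_equation h₂ h₃ hz hzL hzM

theorem countable_lattice (L : PeriodPair) : (L.lattice : Set ℂ).Countable :=
  have : Countable L.lattice := L.latticeEquivProd.toEquiv.countable_iff.mpr inferInstance
  Set.to_countable _

theorem eqOn_weierstrassP_of_invariants_eq {L M : PeriodPair} (h₂ : L.g₂ = M.g₂)
    (h₃ : L.g₃ = M.g₃) :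
    Set.EqOn L.weierstrassP M.weierstrassP ((L.lattice : Set ℂ) ∪ M.lattice)ᶜ := by
  have hcount := (countable_lattice L).union (countable_lattice M)
  have hL : AnalyticOnNhd ℂ L.weierstrassP ((L.lattice : Set ℂ) ∪ M.lattice)ᶜ :=
    L.analyticOnNhd_weierstrassP.mono (Set.compl_subset_compl.mpr Set.subset_union_left)
  have hM : AnalyticOnNhd ℂ M.weierstrassP ((L.lattice : Set ℂ) ∪ M.lattice)ᶜ :=
    M.analyticOnNhd_weierstrassP.mono (Set.compl_subset_compl.mpr Set.subset_union_right)
  have hnear : ∀ᶠ z in 𝓝 (0 : ℂ), L.weierstrassP z = M.weierstrassP z := by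
    filter_upwards [eventually_weierstrassPExcept_zero_eq h₂ h₃] with z hz
    simp only [weierstrassP_eq_weierstrassPExcept_zero, sub_eq_zero.mp hz]
  obtain ⟨V, hVsub, hVo, h0V⟩ := eventually_nhds_iff.mp hnear
  obtain ⟨z₀, hz₀U, hz₀V⟩ := (hcount.dense_compl ℝ).exists_mem_open hVo ⟨0, h0V⟩
  exact hL.eqOn_of_preconnected_of_eventuallyEq hM
    (hcount.isConnected_compl_of_one_lt_rank (by simp)).isPreconnected hz₀U
    (by filter_upwards [hVo.mem_nhds hz₀V] with z hz using hVsub z hz)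

theorem lattice_subset_of_invariants_eq {L M : PeriodPair} (h₂ : L.g₂ = M.g₂)
    (h₃ : L.g₃ = M.g₃) : (L.lattice : Set ℂ) ⊆ M.lattice := by
  intro l hl
  by_contra hlM
  have heq : L.weierstrassP =ᶠ[𝓝[≠] l] M.weierstrassP := by
    filter_upwards [mem_nhdsWithin_of_mem_nhds (L.compl_lattice_sdiff_singleton_mem_nhds l),
      mem_nhdsWithin_of_mem_nhds (M.isClosed_lattice.isOpen_compl.mem_nhds hlM),
      self_mem_nhdsWithin] with z hz hzM hzl
    exact eqOn_weierstrassP_of_invariants_eq h₂ h₃ fun h ↦ h.elim (fun h ↦ hz ⟨h, hzl⟩) hzM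
  have hpole : meromorphicOrderAt M.weierstrassP l = -2 := by
    rw [← meromorphicOrderAt_congr heq, L.order_weierstrassP l hl]
  have hreg := (M.analyticOnNhd_weierstrassP l hlM).meromorphicOrderAt_nonneg
  rw [hpole] at hreg
  exact absurd hreg (by decide)

theorem lattice_eq_of_invariants_eq {L M : PeriodPair} (h₂ : L.g₂ = M.g₂) (h₃ : L.g₃ = M.g₃) :
    (L.lattice : Set ℂ) = M.lattice :=
  (lattice_subset_of_invariants_eq h₂ h₃).antisymm
    (lattice_subset_of_invariants_eq h₂.symm h₃.symm)

end Weierstrass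

/-! ### The `j`-invariant -/

theorem int_coeff_eq_of_combination_eq (L : PeriodPair) {m n m' n' : ℤ}
    (h : (m : ℂ) * L.ω₁ + n * L.ω₂ = m' * L.ω₁ + n' * L.ω₂) : m = m' ∧ n = n' := by
  have hzero : ((m - m' : ℝ)) • L.ω₁ + ((n - n' : ℝ)) • L.ω₂ = 0 := by
    simp only [Complex.real_smul]
    push_cast
    linear_combination h
  have := LinearIndependent.pair_iff.mp L.indep _ _ hzero
  simpa only [sub_eq_zero, Int.cast_inj] using this

theorem exists_isUnit_det_of_lattice_eq {L M : PeriodPair}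
    (h : (L.lattice : Set ℂ) = M.lattice) :
    ∃ a b c d : ℤ, IsUnit (a * d - b * c) ∧
      L.ω₁ = a * M.ω₁ + b * M.ω₂ ∧ L.ω₂ = c * M.ω₁ + d * M.ω₂ := by
  have hmem (x : ℂ) : (∃ m n : ℤ, (m : ℂ) * L.ω₁ + n * L.ω₂ = x) ↔
      ∃ m n : ℤ, (m : ℂ) * M.ω₁ + n * M.ω₂ = x := by
    simpa only [SetLike.mem_coe, PeriodPair.mem_lattice] using Set.ext_iff.mp h x
  obtain ⟨a, b, hab⟩ := (hmem L.ω₁).mp ⟨1, 0, by simp⟩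
  obtain ⟨c, d, hcd⟩ := (hmem L.ω₂).mp ⟨0, 1, by simp⟩
  obtain ⟨a', b', hab'⟩ := (hmem M.ω₁).mpr ⟨1, 0, by simp⟩
  obtain ⟨c', d', hcd'⟩ := (hmem M.ω₂).mpr ⟨0, 1, by simp⟩
  obtain ⟨h₁₁, h₁₂⟩ : a * a' + b * c' = 1 ∧ a * b' + b * d' = 0 :=
    int_coeff_eq_of_combination_eq L (by
      rw [← hab', ← hcd'] at hab
      push_cast
      linear_combination hab)
  obtain ⟨-, h₂₂⟩ : c * a' + d * c' = 0 ∧ c * b' + d * d' = 1 :=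
    int_coeff_eq_of_combination_eq L (by
      rw [← hab', ← hcd'] at hcd
      push_cast
      linear_combination hcd)
  refine ⟨a, b, c, d, IsUnit.of_mul_eq_one (a' * d' - b' * c') ?_, hab.symm, hcd.symm⟩
  linear_combination (c * b' + d * d') * h₁₁ + h₂₂ - (c * a' + d * c') * h₁₂

theorem im_mul_normSq_of_mul_eq {z w : ℂ} {a b c d : ℝ}
    (h : z * (c * w + d) = a * w + b) :
    z.im * Complex.normSq (c * w + d) = (a * d - b * c) * w.im := by
  have him := congrArg Complex.im h
  have hre := congrArg Complex.re h
  simp only [Complex.mul_im, Complex.mul_re, Complex.add_im, Complex.add_re, Complex.ofReal_re,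
    Complex.ofReal_im, zero_mul, add_zero, sub_zero] at him hre
  rw [Complex.normSq_apply]
  simp only [Complex.mul_im, Complex.mul_re, Complex.add_im, Complex.add_re, Complex.ofReal_re,
    Complex.ofReal_im, zero_mul, add_zero, sub_zero]
  linear_combination (c * w.re + d) * him - c * w.im * hre

theorem exists_smul_eq_of_mul_eq {z w : ℍ} {a b c d : ℤ} (hunit : IsUnit (a * d - b * c))
    (h : (z : ℂ) * (c * w + d) = a * w + b) : ∃ γ : SL(2, ℤ), γ • w = z := by
  have hden : (c : ℂ) * w + d ≠ 0 := by
    intro h0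
    have hc : c = 0 := by simpa [w.im_ne_zero] using congrArg Complex.im h0
    have hd : d = 0 := by simpa [hc] using h0
    simp [hc, hd] at hunit
  have him : z.im * Complex.normSq (c * w + d) = (a * d - b * c : ℤ) * w.im := by
    rw [← coe_im, ← coe_im]
    exact_mod_cast im_mul_normSq_of_mul_eq (a := a) (b := b) (c := c) (d := d)
      (by exact_mod_cast h)
  have hpos : 0 < ((a * d - b * c : ℤ) : ℝ) := by
    refine pos_of_mul_pos_left ?_ w.im_pos.le
    rw [← him]
    exact mul_pos z.im_pos (Complex.normSq_pos.mpr hden)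
  have hdet : a * d - b * c = 1 :=
    (Int.isUnit_iff.mp hunit).resolve_right fun h ↦ by norm_num [h] at hpos
  let γ : SL(2, ℤ) := ⟨!![a, b; c, d], by simpa [Matrix.det_fin_two] using hdet⟩
  refine ⟨γ, UpperHalfPlane.ext ?_⟩
  rw [specialLinearGroup_apply]
  simpa [γ] using (eq_div_of_mul_eq hden h).symm

/-- The lattice `μ (ℤ z + ℤ)` attached to a point `z` of the upper half-plane, with its
basis `(μ z, μ)`. -/
def periodPair (z : ℍ) (μ : ℂ) (hμ : μ ≠ 0) : PeriodPair where
  ω₁ := μ * z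
  ω₂ := μ
  indep := by
    rw [LinearIndependent.pair_iff]
    intro s t h
    have h' : (s : ℂ) * z + t = 0 := by
      apply mul_left_cancel₀ hμ
      simp only [Complex.real_smul] at h
      linear_combination h
    have hs : s = 0 := by simpa [z.im_ne_zero] using congrArg Complex.im h'
    subst hs
    simpa using h'

theorem periodPair_G (z : ℍ) (μ : ℂ) (hμ : μ ≠ 0) {k : ℕ} (hk : 3 ≤ k) :
    (periodPair z μ hμ).G k = (μ ^ k)⁻¹ * (2 * riemannZeta k * ModularForm.E hk z) := by
  have hE : ModularForm.E hk z = (1 / 2 : ℂ) * eisensteinSeries (N := 1) 0 k z := rfl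
  rw [hE, show 2 * riemannZeta k * ((1 / 2 : ℂ) * eisensteinSeries (N := 1) 0 k z) =
    riemannZeta k * eisensteinSeries (N := 1) 0 k z by ring,
    ← tsum_eisSummand_eq_riemannZeta_mul_eisensteinSeries hk z, ← tsum_mul_left,
    PeriodPair.G, ← (periodPair z μ hμ).latticeEquivProd.symm.toEquiv.tsum_eq,
    ← (finTwoArrowEquiv ℤ).tsum_eq]
  refine tsum_congr fun v ↦ ?_
  change (((periodPair z μ hμ).latticeEquivProd.symm (v 0, v 1) : ℂ) ^ k)⁻¹ = _
  rw [(periodPair z μ hμ).latticeEquiv_symm_apply (v 0, v 1), eisSummand, zpow_neg, ← mul_inv,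
    zpow_natCast, ← mul_pow]
  simp only [periodPair]
  ring_nf

theorem exists_smul_eq_of_lattice_eq {z w : ℍ} {μ ν : ℂ} {hμ : μ ≠ 0} {hν : ν ≠ 0}
    (h : ((periodPair z μ hμ).lattice : Set ℂ) = (periodPair w ν hν).lattice) :
    ∃ γ : SL(2, ℤ), γ • w = z := by
  obtain ⟨a, b, c, d, hunit, h₁, h₂⟩ := exists_isUnit_det_of_lattice_eq h
  simp only [periodPair] at h₁ h₂
  refine exists_smul_eq_of_mul_eq hunit (mul_left_cancel₀ hν ?_)
  linear_combination h₁ - z * h₂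

/-- The `j`-invariant, normalised as `E₄³ / Δ`, so that `j = 1728` at `i`. -/
def jInv (z : ℍ) : ℂ := E₄ z ^ 3 / discriminant z

theorem levelOne_smul {k : ℤ} (f : ModularForm 𝒮ℒ k) (γ : SL(2, ℤ)) (z : ℍ) :
    f (γ • z) = denom γ z ^ k * f z :=
  SlashInvariantForm.slash_action_eqn'' f (MonoidHom.mem_range.mpr ⟨γ, rfl⟩) z

theorem discriminant_smul (γ : SL(2, ℤ)) (z : ℍ) :
    discriminant (γ • z) = denom γ z ^ (12 : ℤ) * discriminant z :=
  SlashInvariantForm.slash_action_eqn'' CuspForm.discriminant (MonoidHom.mem_range.mpr ⟨γ, rfl⟩) z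

theorem jInv_smul (γ : SL(2, ℤ)) (z : ℍ) : jInv (γ • z) = jInv z := by
  rw [jInv, jInv, levelOne_smul, discriminant_smul, mul_pow, ← zpow_natCast, ← zpow_mul]
  exact mul_div_mul_left _ _ (zpow_ne_zero _ (denom_ne_zero γ z))

theorem exists_root_of_unity_mul_eq {n : ℕ} (hn : n ≠ 0) {x y : ℂ} (h : x ^ n = y ^ n) :
    ∃ ω : ℂ, ω ^ n = 1 ∧ x = ω * y := by
  rcases eq_or_ne y 0 with rfl | hy
  · exact ⟨1, one_pow n, by simpa [hn] using h⟩
  · exact ⟨x / y, by rw [div_pow, h, div_self (pow_ne_zero n hy)], (div_mul_cancel₀ x hy).symm⟩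

theorem exists_scaling_of_jInv_eq {z w : ℍ} (h : jInv z = jInv w) :
    ∃ l : ℂ, l ≠ 0 ∧ E₄ z ^ 3 = (l ^ 4 * E₄ w) ^ 3 ∧ E₆ z ^ 2 = (l ^ 6 * E₆ w) ^ 2 := by
  have hz := discriminant_ne_zero z
  have hw := discriminant_ne_zero w
  obtain ⟨l, hl⟩ := IsAlgClosed.exists_pow_nat_eq (discriminant z / discriminant w)
    (n := 12) (by norm_num)
  have hl0 : l ≠ 0 := fun h0 ↦ div_ne_zero hz hw (by simp [← hl, h0])
  rw [eq_div_iff hw] at hl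
  rw [jInv, jInv, div_eq_div_iff hz hw] at h
  have h4 : E₄ z ^ 3 = (l ^ 4 * E₄ w) ^ 3 := by
    apply mul_right_cancel₀ hw
    rw [h, ← hl]
    ring
  refine ⟨l, hl0, h4, ?_⟩
  linear_combination h4 + 1728 * discriminant_eq_E₄_cube_sub_E₆_sq z -
    1728 * l ^ 12 * discriminant_eq_E₄_cube_sub_E₆_sq w + 1728 * hl

theorem exists_smul_eq_of_E₄_E₆_eq {z w : ℍ} {l : ℂ} (hl : l ≠ 0) (h4 : E₄ z = l ^ 4 * E₄ w)
    (h6 : E₆ z = l ^ 6 * E₆ w) : ∃ γ : SL(2, ℤ), γ • w = z := by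
  refine exists_smul_eq_of_lattice_eq (hμ := one_ne_zero) (hν := inv_ne_zero hl)
    (lattice_eq_of_invariants_eq ?_ ?_)
  · rw [PeriodPair.g₂, PeriodPair.g₂, periodPair_G _ _ _ (by norm_num),
      periodPair_G _ _ _ (by norm_num), h4, inv_pow, inv_inv]
    ring
  · rw [PeriodPair.g₃, PeriodPair.g₃, periodPair_G _ _ _ (by norm_num),
      periodPair_G _ _ _ (by norm_num), h6, inv_pow, inv_inv]
    ring

theorem exists_smul_eq_of_jInv_eq {z w : ℍ} (h : jInv z = jInv w) :
    ∃ γ : SL(2, ℤ), γ • w = z := by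
  obtain ⟨l, hl, h4, h6⟩ := exists_scaling_of_jInv_eq h
  obtain ⟨ω, hω, h4⟩ := exists_root_of_unity_mul_eq (by norm_num) h4
  obtain ⟨s, hs, h6⟩ := exists_root_of_unity_mul_eq (by norm_num) h6
  obtain ⟨t, ht⟩ := IsAlgClosed.exists_pow_nat_eq s two_pos
  have hω0 : ω ≠ 0 := by
    rintro rfl
    simp at hω
  have ht0 : t ≠ 0 := by
    rintro rfl
    simp [← ht] at hs
  refine exists_smul_eq_of_E₄_E₆_eq (l := l * ω * t) (by simp [hl, hω0, ht0]) ?_ ?_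
  · rw [h4]
    linear_combination (-ω * l ^ 4 * E₄ w) * (hω * t ^ 4 + (t ^ 2 + s) * ht + hs)
  · rw [h6]
    linear_combination (-l ^ 6 * E₆ w) * ((ω ^ 3 + 1) * hω * t ^ 6 +
      (t ^ 4 + t ^ 2 * s + s ^ 2) * ht + s * hs)

theorem jInv_eq_iff {z w : ℍ} : jInv z = jInv w ↔ z ∈ MulAction.orbit SL(2, ℤ) w := by
  refine ⟨exists_smul_eq_of_jInv_eq, ?_⟩
  rintro ⟨γ, rfl⟩
  exact jInv_smul γ w

/-! ### Level one modular forms -/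

section LevelOne

open scoped Manifold

/-- The level one modular form with underlying function `f`. For level one the growth condition
is only needed at the cusp `i∞`. -/
def ofLevelOne {k : ℤ} (f : ℍ → ℂ) (hS : f ∣[k] ModularGroup.S = f)
    (hT : f ∣[k] ModularGroup.T = f) (hf : MDiff f) (hb : IsBoundedAtImInfty f) :
    ModularForm 𝒮ℒ k where
  toFun := f
  slash_action_eq' A hA := by
    obtain ⟨A, rfl⟩ := hA
    exact SlashInvariantForm.slash_action_generators_SL2Z hS hT A
  holo' := hf
  bdd_at_cusps' {c} hc := by
    rw [Subgroup.IsArithmetic.isCusp_iff_isCusp_SL2Z] at hc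
    rw [OnePoint.isBoundedAt_iff_forall_SL2Z hc]
    intro γ _
    rwa [SlashInvariantForm.slash_action_generators_SL2Z hS hT γ]

theorem tendsto_atImInfty_of_hasSum {f : ℍ → ℂ} {c : ℕ → ℂ}
    (hf : ∀ τ : ℍ, HasSum (fun m ↦ c m * Function.Periodic.qParam 1 τ ^ m) (f τ)) :
    Tendsto f atImInfty (𝓝 (c 0)) := by
  have hlim : Tendsto (fun τ : ℍ ↦ ∑' m, c m * Function.Periodic.qParam 1 τ ^ m) atImInfty
      (𝓝 (∑' m, c m * (0 : ℂ) ^ m)) := by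
    refine tendsto_tsum_of_dominated_convergence (hf I).summable.norm
      (fun m ↦ ((qParam_tendsto_atImInfty one_pos).pow m).const_mul (c m)) ?_
    filter_upwards [(atImInfty_mem _).mpr ⟨1, fun z hz ↦ hz⟩] with τ (hτ : 1 ≤ τ.im) m
    rw [norm_mul, norm_mul, norm_pow, norm_pow]
    gcongr
    rw [Function.Periodic.norm_qParam, Function.Periodic.norm_qParam, Real.exp_le_exp]
    simpa [Real.pi_pos] using hτ
  rw [tsum_eq_single 0 fun m hm ↦ by simp [hm], pow_zero, mul_one] at hlim
  exact hlim.congr fun τ ↦ (hf τ).tsum_eq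

theorem tendsto_levelOne_atImInfty {k : ℤ} (f : ModularForm 𝒮ℒ k) :
    Tendsto f atImInfty (𝓝 ((qExpansion 1 f).coeff 0)) :=
  tendsto_atImInfty_of_hasSum (ModularForm.hasSum_qExpansion f one_pos one_mem_strictPeriods_SL)

theorem tendsto_E₄_atImInfty : Tendsto E₄ atImInfty (𝓝 1) := by
  simpa only [E_qExpansion_coeff_zero _ ⟨2, rfl⟩] using tendsto_levelOne_atImInfty E₄

theorem tendsto_E₆_atImInfty : Tendsto E₆ atImInfty (𝓝 1) := by
  simpa only [E_qExpansion_coeff_zero _ ⟨3, rfl⟩] using tendsto_levelOne_atImInfty E₆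

theorem tendsto_E2_atImInfty : Tendsto E2 atImInfty (𝓝 1) := by
  simpa using tendsto_atImInfty_of_hasSum
    (c := fun m ↦ if m = 0 then 1 else -24 * ArithmeticFunction.sigma 1 m)
    fun τ ↦ by simpa [Function.Periodic.qParam] using hasSum_qExpansion_E2 (z := τ)

theorem normalizedDerivOfComplex_eq_deriv_cuspFunction {k : ℤ} (f : ModularForm 𝒮ℒ k) (z : ℍ) :
    Derivative.normalizedDerivOfComplex f z =
      deriv (cuspFunction 1 f) (Function.Periodic.qParam 1 z) * Function.Periodic.qParam 1 z := by
  have heq : (f ∘ ofComplex) =ᶠ[𝓝 (z : ℂ)] (cuspFunction 1 f ∘ Function.Periodic.qParam 1) := by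
    filter_upwards [isOpen_upperHalfPlaneSet.mem_nhds z.im_pos] with w hw
    simpa [ofComplex_apply_of_im_pos hw] using (SlashInvariantFormClass.eq_cuspFunction f ⟨w, hw⟩
      one_mem_strictPeriods_SL one_ne_zero).symm
  have hd := ModularFormClass.differentiableAt_cuspFunction f one_pos one_mem_strictPeriods_SL
    (Function.Periodic.norm_qParam_lt_one one_pos z.im_pos)
  have hq : deriv (Function.Periodic.qParam 1) (z : ℂ) =
      2 * Real.pi * Complex.I * Function.Periodic.qParam 1 z := by
    have := logDeriv_qParam 1 (z : ℂ)
    rwa [logDeriv_apply, div_eq_iff (Function.Periodic.qParam_ne_zero _), Complex.ofReal_one,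
      div_one] at this
  rw [Derivative.normalizedDerivOfComplex, heq.deriv_eq,
    deriv_comp _ hd Function.Periodic.differentiable_qParam.differentiableAt, hq]
  have := Complex.two_pi_I_ne_zero
  field_simp

theorem tendsto_normalizedDerivOfComplex_atImInfty {k : ℤ} (f : ModularForm 𝒮ℒ k) :
    Tendsto (Derivative.normalizedDerivOfComplex f) atImInfty (𝓝 0) := by
  have hanal := ModularFormClass.analyticAt_cuspFunction_zero f one_pos one_mem_strictPeriods_SL
  have hq := qParam_tendsto_atImInfty one_pos
  simpa [Function.comp_def, ← normalizedDerivOfComplex_eq_deriv_cuspFunction] using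
    (hanal.deriv.continuousAt.tendsto.comp hq).mul hq

theorem tendsto_serreDerivative_atImInfty {k : ℤ} (f : ModularForm 𝒮ℒ k) {c : ℂ}
    (hf : Tendsto f atImInfty (𝓝 c)) :
    Tendsto (Derivative.serreDerivative k f) atImInfty (𝓝 (-(k / 12) * c)) := by
  have := (tendsto_normalizedDerivOfComplex_atImInfty f).sub
    ((tendsto_E2_atImInfty.const_mul (k * 12⁻¹ : ℂ)).mul hf)
  rw [show 0 - (k * 12⁻¹ : ℂ) * 1 * c = -(k / 12) * c by ring] at this
  exact this.congr fun z ↦ (Derivative.serreDerivative_apply k f z).symm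

/-- One of Ramanujan's differential equations. -/
theorem serreDerivative_E₄ (z : ℍ) : Derivative.serreDerivative 4 E₄ z = -(1 / 3) * E₆ z := by
  have hinv (γ : SL(2, ℤ)) : Derivative.serreDerivative 4 E₄ ∣[(6 : ℤ)] γ =
      Derivative.serreDerivative 4 E₄ := by
    exact_mod_cast Derivative.serreDerivative_slash_invariant (k := 4) (γ := γ) E₄.holo'
      (E₄.slash_action_eq' _ ⟨γ, rfl⟩)
  have hlim : Tendsto (Derivative.serreDerivative 4 E₄) atImInfty (𝓝 (-(1 / 3))) := by
    have := tendsto_serreDerivative_atImInfty E₄ tendsto_E₄_atImInfty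
    norm_num at this ⊢
    exact this
  let f : ModularForm 𝒮ℒ 6 := ofLevelOne _ (hinv _) (hinv _)
    (Derivative.serreDerivative_mdifferentiable 4 E₄.holo') (hlim.isBigO_one ℝ)
  obtain ⟨c, hc⟩ : ∃ c : ℂ, c • E₆ = f :=
    (finrank_eq_one_iff_of_nonzero' E₆ (E_ne_zero _ ⟨3, rfl⟩)).mp
      (Module.rank_eq_one_iff_finrank_eq_one.mp levelOne_weight_six_rank_one) _
  have hcz (z : ℍ) : c * E₆ z = Derivative.serreDerivative 4 E₄ z := DFunLike.congr_fun hc z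
  have hclim := (tendsto_E₆_atImInfty.const_mul c).congr hcz
  rw [← hcz, tendsto_nhds_unique hlim hclim, mul_one]

theorem hasDerivAt_E₄ (z : ℍ) : HasDerivAt (E₄ ∘ ofComplex)
    (2 * Real.pi * Complex.I / 3 * (E2 z * E₄ z - E₆ z)) z := by
  have hd : DifferentiableAt ℂ (E₄ ∘ ofComplex) z := mdifferentiableAt_iff.mp (E₄.holo' z)
  refine hd.hasDerivAt.congr_deriv ?_
  have h := serreDerivative_E₄ z
  have := Complex.two_pi_I_ne_zero
  rw [Derivative.serreDerivative_apply, Derivative.normalizedDerivOfComplex] at h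
  field_simp at h ⊢
  linear_combination h / 12

theorem hasDerivAt_discriminant (z : ℍ) : HasDerivAt (discriminant ∘ ofComplex)
    (2 * Real.pi * Complex.I * E2 z * discriminant z) z := by
  have hη := (differentiableAt_eta_of_mem_upperHalfPlaneSet z.2).hasDerivAt
  have hlog := logDeriv_eta_eq_E2 z
  rw [logDeriv_apply, div_eq_iff (eta_ne_zero z.2)] at hlog
  have heq : (discriminant ∘ ofComplex) =ᶠ[𝓝 (z : ℂ)] fun w ↦ eta w ^ 24 := by
    filter_upwards [isOpen_upperHalfPlaneSet.mem_nhds z.im_pos] with w hw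
    simp [discriminant, ofComplex_apply_of_im_pos hw]
  refine ((hη.pow 24).congr_of_eventuallyEq heq).congr_deriv ?_
  rw [hlog, discriminant]
  push_cast
  ring

theorem hasDerivAt_jInv (z : ℍ) : HasDerivAt (jInv ∘ ofComplex)
    (-(2 * Real.pi * Complex.I) * (E₄ z ^ 2 * E₆ z / discriminant z)) z := by
  have hz := discriminant_ne_zero z
  refine (((hasDerivAt_E₄ z).pow 3).div (hasDerivAt_discriminant z)
    (by simpa using hz)).congr_deriv ?_
  simp only [Function.comp_apply, ofComplex_apply, Pi.pow_apply]
  field_simp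
  push_cast
  ring

theorem mdifferentiable_E₄_cube_sub_mul_discriminant (r : ℂ) :
    MDiff (fun z ↦ E₄ z ^ 3 - r * discriminant z) := by
  have h4 := UpperHalfPlane.mdifferentiable_iff.mp E₄.holo'
  have hΔ := UpperHalfPlane.mdifferentiable_iff.mp CuspForm.discriminant.holo'
  exact UpperHalfPlane.mdifferentiable_iff.mpr ((h4.pow 3).sub (hΔ.const_mul r))

theorem E₄_cube_sub_mul_discriminant_smul (r : ℂ) (γ : SL(2, ℤ)) (z : ℍ) :
    E₄ (γ • z) ^ 3 - r * discriminant (γ • z) =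
      denom γ z ^ (12 : ℤ) * (E₄ z ^ 3 - r * discriminant z) := by
  rw [levelOne_smul, discriminant_smul, mul_pow, ← zpow_natCast _ 3, ← zpow_mul]
  norm_num
  ring

/-- If `j` omitted the value `r`, then `(E₄³ - r Δ)⁻¹` would be a modular form of weight `-12`. -/
theorem exists_jInv_eq (r : ℂ) : ∃ z, jInv z = r := by
  by_contra! hne
  have hf0 (z : ℍ) : E₄ z ^ 3 - r * discriminant z ≠ 0 := fun h ↦ hne z <| by
    rw [jInv, div_eq_iff (discriminant_ne_zero z)]
    linear_combination h
  have hlim : Tendsto (fun z ↦ (E₄ z ^ 3 - r * discriminant z)⁻¹) atImInfty (𝓝 1) := by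
    have hΔ : Tendsto discriminant atImInfty (𝓝 0) := discriminant_isZeroAtImInfty
    simpa using ((tendsto_E₄_atImInfty.pow 3).sub (hΔ.const_mul r)).inv₀ (by simp)
  have hinv (γ : SL(2, ℤ)) : (fun z ↦ (E₄ z ^ 3 - r * discriminant z)⁻¹) ∣[(-12 : ℤ)] γ =
      fun z ↦ (E₄ z ^ 3 - r * discriminant z)⁻¹ := by
    ext z
    rw [SL_slash_apply, neg_neg, E₄_cube_sub_mul_discriminant_smul, mul_inv, mul_comm, ← mul_assoc,
      mul_inv_cancel₀ (zpow_ne_zero _ (denom_ne_zero γ z)), one_mul]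
  have hMD : MDiff (fun z ↦ (E₄ z ^ 3 - r * discriminant z)⁻¹) :=
    UpperHalfPlane.mdifferentiable_iff.mpr
      ((UpperHalfPlane.mdifferentiable_iff.mp (mdifferentiable_E₄_cube_sub_mul_discriminant r)).inv
        fun x _ ↦ hf0 _)
  let f : ModularForm 𝒮ℒ (-12) := ofLevelOne _ (hinv _) (hinv _) hMD (hlim.isBigO_one ℝ)
  exact inv_ne_zero (hf0 I)
    (congrFun (ModularFormClass.levelOne_neg_weight_eq_zero (by norm_num) f) I)

end LevelOne

/-! ### Orders of vanishing and the ramification of `j` -/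

section Ramification

open scoped Manifold

/-- The order of vanishing at `z` of a function on the upper half-plane, read in the coordinate
of `ℂ`. -/
def ord (f : ℍ → ℂ) (z : ℍ) : ℕ∞ := analyticOrderAt (f ∘ ofComplex) z

theorem analyticAt_comp_ofComplex {f : ℍ → ℂ} (hf : MDiff f) (z : ℍ) :
    AnalyticAt ℂ (f ∘ ofComplex) z :=
  (UpperHalfPlane.mdifferentiable_iff.mp hf).analyticAt
    (isOpen_upperHalfPlaneSet.mem_nhds z.im_pos)

theorem ord_comp_coe (g : ℂ → ℂ) (z : ℍ) : ord (fun w ↦ g w) z = analyticOrderAt g z := by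
  refine analyticOrderAt_congr ?_
  filter_upwards [isOpen_upperHalfPlaneSet.mem_nhds z.im_pos] with w hw
  simp [ofComplex_apply_of_im_pos hw]

theorem ord_eq_zero_iff {f : ℍ → ℂ} (hf : MDiff f) {z : ℍ} : ord f z = 0 ↔ f z ≠ 0 := by
  rw [ord, (analyticAt_comp_ofComplex hf z).analyticOrderAt_eq_zero, Function.comp_apply,
    ofComplex_apply]

theorem ord_mul {f g : ℍ → ℂ} (hf : MDiff f) (hg : MDiff g) (z : ℍ) :
    ord (f * g) z = ord f z + ord g z :=
  analyticOrderAt_mul (analyticAt_comp_ofComplex hf z) (analyticAt_comp_ofComplex hg z)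

theorem ord_pow {f : ℍ → ℂ} (hf : MDiff f) (n : ℕ) (z : ℍ) : ord (f ^ n) z = n * ord f z := by
  rw [← nsmul_eq_mul]
  exact analyticOrderAt_pow (analyticAt_comp_ofComplex hf z) n

theorem analyticOrderAt_prod {𝕜 ι : Type*} [NontriviallyNormedField 𝕜] {s : Finset ι}
    {f : ι → 𝕜 → 𝕜} {z : 𝕜} (hf : ∀ i ∈ s, AnalyticAt 𝕜 (f i) z) :
    analyticOrderAt (∏ i ∈ s, f i) z = ∑ i ∈ s, analyticOrderAt (f i) z := by
  classical
  induction s using Finset.induction_on with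
  | empty => exact analyticAt_const.analyticOrderAt_eq_zero.mpr one_ne_zero
  | insert i s hi ih =>
    rw [Finset.forall_mem_insert] at hf
    rw [Finset.prod_insert hi, Finset.sum_insert hi,
      analyticOrderAt_mul hf.1 (Finset.analyticAt_prod s hf.2), ih hf.2]

theorem ord_prod {ι : Type*} {s : Finset ι} {f : ι → ℍ → ℂ} (hf : ∀ i ∈ s, MDiff (f i)) (z : ℍ) :
    ord (∏ i ∈ s, f i) z = ∑ i ∈ s, ord (f i) z := by
  have hcomp : (∏ i ∈ s, f i) ∘ ofComplex = ∏ i ∈ s, f i ∘ ofComplex := by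
    ext w
    simp
  rw [ord, hcomp, analyticOrderAt_prod fun i hi ↦ analyticAt_comp_ofComplex (hf i hi) z]
  rfl

theorem ord_mul_eq_left {f g : ℍ → ℂ} (hf : MDiff f) (hg : MDiff g) {z : ℍ} (hz : g z ≠ 0) :
    ord (f * g) z = ord f z := by
  rw [ord_mul hf hg, (ord_eq_zero_iff hg).mpr hz, add_zero]

theorem ord_ne_top {f : ℍ → ℂ} (hf : MDiff f) (h0 : f ≠ 0) (z : ℍ) : ord f z ≠ ⊤ := by
  refine fun h ↦ h0 (eq_zero_of_frequently hf (τ := z) ?_)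
  have hev : ∀ᶠ w : ℍ in 𝓝 z, f w = 0 := by
    simpa using (continuous_coe.tendsto z).eventually (analyticOrderAt_eq_top.mp h)
  exact (hev.filter_mono nhdsWithin_le_nhds).frequently

theorem mdifferentiable_E₄ : MDiff E₄ := E₄.holo'

theorem mdifferentiable_E₆ : MDiff E₆ := E₆.holo'

theorem mdifferentiable_discriminant : MDiff discriminant :=
  CuspForm.discriminant.holo'

theorem mdifferentiable_jInv : MDiff jInv :=
  UpperHalfPlane.mdifferentiable_iff.mpr <|
    ((UpperHalfPlane.mdifferentiable_iff.mp E₄.holo').pow 3).div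
      (UpperHalfPlane.mdifferentiable_iff.mp mdifferentiable_discriminant)
      fun _ _ ↦ discriminant_ne_zero _

theorem jInv_mul_discriminant (z : ℍ) : jInv z * discriminant z = E₄ z ^ 3 :=
  div_mul_cancel₀ _ (discriminant_ne_zero z)

theorem jInv_sub_mul_discriminant (z : ℍ) : (jInv z - 1728) * discriminant z = E₆ z ^ 2 := by
  linear_combination jInv_mul_discriminant z - 1728 * discriminant_eq_E₄_cube_sub_E₆_sq z

theorem jInv_eq_zero_iff {z : ℍ} : jInv z = 0 ↔ E₄ z = 0 := by
  have h := jInv_mul_discriminant z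
  rw [← pow_eq_zero_iff three_ne_zero (a := E₄ z), ← h, mul_eq_zero,
    or_iff_left (discriminant_ne_zero z)]

theorem jInv_eq_1728_iff {z : ℍ} : jInv z = 1728 ↔ E₆ z = 0 := by
  have h := jInv_sub_mul_discriminant z
  rw [← pow_eq_zero_iff two_ne_zero (a := E₆ z), ← h, mul_eq_zero, sub_eq_zero,
    or_iff_left (discriminant_ne_zero z)]

theorem S_smul_I : ModularGroup.S • I = I := by
  ext1
  rw [modular_S_smul]
  simp

theorem S_smul_T_smul_ρ : ModularGroup.S • ModularGroup.T • ρ = ρ := by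
  have hρ : (ρ : ℂ) * (1 + ρ) = -1 := by linear_combination ρ_sq
  rw [modular_T_smul, modular_S_smul]
  ext1
  rw [coe_mk, coe_vadd, Complex.ofReal_one]
  refine (eq_inv_of_mul_eq_one_left ?_).symm
  linear_combination -hρ

theorem denom_T (z : ℍ) : denom (ModularGroup.T : SL(2, ℤ)) z = 1 := by
  rw [ModularGroup.denom_apply]
  simp [ModularGroup.T]

theorem E₆_I : E₆ I = 0 := by
  have h := levelOne_smul E₆ ModularGroup.S I
  have hI : (I : ℂ) ^ (6 : ℤ) = -1 := by
    rw [coe_I, zpow_ofNat, Complex.I_pow_eq_pow_mod, Complex.I_sq]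
  rw [S_smul_I, ModularGroup.denom_S, hI] at h
  linear_combination h / 2

theorem E₄_ρ : E₄ ρ = 0 := by
  have h := levelOne_smul E₄ ModularGroup.S (ModularGroup.T • ρ)
  rw [S_smul_T_smul_ρ, levelOne_smul E₄ ModularGroup.T ρ, denom_T, ModularGroup.denom_S,
    modular_T_smul, coe_vadd, one_zpow, one_mul, Complex.ofReal_one, zpow_ofNat] at h
  have h2 : (2 + (ρ : ℂ)) * E₄ ρ = 0 := by
    linear_combination h + ((ρ : ℂ) ^ 2 + 3 * ρ + 2) * ρ_sq * E₄ ρ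
  refine (mul_eq_zero.mp h2).resolve_left fun h0 ↦ ρ.im_ne_zero ?_
  simpa using congrArg Complex.im h0

theorem jInv_I : jInv I = 1728 := jInv_eq_1728_iff.mpr E₆_I

theorem jInv_ρ : jInv ρ = 0 := jInv_eq_zero_iff.mpr E₄_ρ

/-- The ramification index of the `j`-invariant, as a map `ℍ → ℂ`. -/
def jRamification (z : ℍ) : ℕ∞ := ord (fun w ↦ jInv w - jInv z) z

theorem mdifferentiable_jInv_sub (r : ℂ) : MDiff (fun w ↦ jInv w - r) :=
  mdifferentiable_jInv.sub mdifferentiable_const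

theorem jRamification_ne_top (z : ℍ) : jRamification z ≠ ⊤ := by
  refine ord_ne_top (mdifferentiable_jInv_sub _) (fun h ↦ ?_) z
  obtain ⟨w, hw⟩ := exists_jInv_eq (jInv z + 1)
  simpa [hw] using congrFun h w

/-- The ramification index exceeds the order of `j'` by one, and `j'` is a constant multiple of
`E₄² E₆ / Δ`. -/
theorem jRamification_eq (z : ℍ) : jRamification z = 2 * ord E₄ z + ord E₆ z + 1 := by
  have hderiv : (deriv (jInv ∘ ofComplex) ∘ (↑)) * discriminant =
      (fun _ : ℍ ↦ -(2 * Real.pi * Complex.I)) * (E₄ ^ 2 * E₆ : ℍ → ℂ) := by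
    ext w
    simp only [Pi.mul_apply, Pi.pow_apply, Function.comp_apply, (hasDerivAt_jInv w).deriv]
    field_simp [discriminant_ne_zero w]
  have hj := UpperHalfPlane.mdifferentiable_iff.mp mdifferentiable_jInv
  have hj' : MDiff (deriv (jInv ∘ ofComplex) ∘ ((↑) : ℍ → ℂ)) := by
    refine UpperHalfPlane.mdifferentiable_iff.mpr
      ((hj.deriv isOpen_upperHalfPlaneSet).congr fun w hw ↦ ?_)
    simp [ofComplex_apply_of_im_pos hw]
  have hord : ord (deriv (jInv ∘ ofComplex) ∘ (↑)) z = 2 * ord E₄ z + ord E₆ z := by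
    have h4 := mdifferentiable_E₄.pow 2
    rw [← ord_mul_eq_left hj' mdifferentiable_discriminant (discriminant_ne_zero z), hderiv,
      mul_comm, ord_mul_eq_left (h4.mul mdifferentiable_E₆) mdifferentiable_const
      (by simp [Real.pi_ne_zero]), ord_mul h4 mdifferentiable_E₆, ord_pow mdifferentiable_E₄]
    rfl
  rw [← hord, Function.comp_def, ord_comp_coe,
    (analyticAt_comp_ofComplex mdifferentiable_jInv z).analyticOrderAt_deriv_add_one]
  simp [jRamification, ord, Function.comp_def]

theorem jRamification_I : jRamification I = 2 := by
  have h4 : ord E₄ I = 0 := (ord_eq_zero_iff mdifferentiable_E₄).mpr fun h ↦ by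
    simpa [jInv_I] using jInv_eq_zero_iff.mpr h
  have h6 : jRamification I = 2 * ord E₆ I := by
    rw [jRamification, ← ord_mul_eq_left (mdifferentiable_jInv_sub _)
      mdifferentiable_discriminant (discriminant_ne_zero I)]
    refine .trans (congrArg (ord · I) ?_) (ord_pow mdifferentiable_E₆ 2 I)
    exact funext fun w ↦ by simpa [jInv_I] using jInv_sub_mul_discriminant w
  have h := jRamification_eq I
  have htop := jRamification_ne_top I
  rw [h6, h4] at h
  rw [h6] at htop ⊢
  cases hE : ord E₆ I with
  | top => simp [hE] at htop
  | coe a => rw [hE] at h; norm_cast at h ⊢; lia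

theorem jRamification_ρ : jRamification ρ = 3 := by
  have h6 : ord E₆ ρ = 0 := (ord_eq_zero_iff mdifferentiable_E₆).mpr fun h ↦ by
    simpa [jInv_ρ] using jInv_eq_1728_iff.mpr h
  have h4 : jRamification ρ = 3 * ord E₄ ρ := by
    rw [jRamification, ← ord_mul_eq_left (mdifferentiable_jInv_sub _)
      mdifferentiable_discriminant (discriminant_ne_zero ρ)]
    refine .trans (congrArg (ord · ρ) ?_) (ord_pow mdifferentiable_E₄ 3 ρ)
    exact funext fun w ↦ by simpa [jInv_ρ] using jInv_mul_discriminant w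
  have h := jRamification_eq ρ
  have htop := jRamification_ne_top ρ
  rw [h4, h6] at h
  rw [h4] at htop ⊢
  cases hE : ord E₄ ρ with
  | top => simp [hE] at htop
  | coe a => rw [hE] at h; norm_cast at h ⊢; lia

theorem jRamification_eq_one {z : ℍ} (hI : z ∉ MulAction.orbit SL(2, ℤ) I)
    (hρ : z ∉ MulAction.orbit SL(2, ℤ) ρ) : jRamification z = 1 := by
  rw [← jInv_eq_iff, jInv_I, jInv_eq_1728_iff, ← ne_eq, ← ord_eq_zero_iff mdifferentiable_E₆] at hI
  rw [← jInv_eq_iff, jInv_ρ, jInv_eq_zero_iff, ← ne_eq, ← ord_eq_zero_iff mdifferentiable_E₄] at hρ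
  simp [jRamification_eq, hI, hρ]

end Ramification

/-! ### The valence formula -/

section Valence

open scoped Manifold

/-- The degree, over a fundamental set `R`, of the divisor with multiplicities `d`. The elliptic
points `i` and `ρ` count with weights `1/2` and `1/3`, the orders of their stabilizers in
`PSL₂(ℤ)`. -/
def orbifoldDegree (R : Set ℍ) (d : ℍ → ℕ∞) : ℚ :=
  (1 / 2 : ℚ) * ((d I).toNat : ℚ) + (1 / 3 : ℚ) * ((d ρ).toNat : ℚ) +
    ∑ᶠ P ∈ nonElliptic R, ((d P).toNat : ℚ)

theorem orbifoldDegree_nat_mul (R : Set ℍ) (n : ℕ) (d : ℍ → ℕ∞) :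
    orbifoldDegree R (fun z ↦ n * d z) = n * orbifoldDegree R d := by
  simp only [orbifoldDegree, ENat.toNat_mul, ENat.toNat_natCast, Nat.cast_mul, ← mul_finsum_mem]
  ring

theorem orbifoldDegree_sum {ι : Type*} {R : Set ℍ} {s : Finset ι} {d : ι → ℍ → ℕ∞}
    (htop : ∀ i ∈ s, ∀ z, d i z ≠ ⊤) (hfin : ∀ i ∈ s, {P | P ∈ R ∧ d i P ≠ 0}.Finite) :
    orbifoldDegree R (fun z ↦ ∑ i ∈ s, d i z) = ∑ i ∈ s, orbifoldDegree R (d i) := by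
  have hcast (z : ℍ) : ((∑ i ∈ s, d i z).toNat : ℚ) = ∑ i ∈ s, ((d i z).toNat : ℚ) := by
    rw [ENat.toNat_sum (htop · · z), Nat.cast_sum]
  have hsum : ∑ᶠ P ∈ nonElliptic R, ∑ i ∈ s, ((d i P).toNat : ℚ) =
      ∑ i ∈ s, ∑ᶠ P ∈ nonElliptic R, ((d i P).toNat : ℚ) := by
    have hind (P : ℍ) : (nonElliptic R).indicator (fun P ↦ ∑ i ∈ s, ((d i P).toNat : ℚ)) P =
        ∑ i ∈ s, (nonElliptic R).indicator (fun P ↦ ((d i P).toNat : ℚ)) P := by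
      by_cases hP : P ∈ nonElliptic R <;> simp [hP]
    simp only [finsum_mem_def, hind]
    refine finsum_sum_comm s _ fun i hi ↦ (hfin i hi).subset fun P hPd ↦ ?_
    have hP := Set.mem_of_indicator_ne_zero hPd
    exact ⟨hP.1, fun h ↦ hPd (by simp [h])⟩
  simp only [orbifoldDegree, hcast, hsum, Finset.sum_add_distrib, Finset.mul_sum]

theorem finite_support_rootMultiplicity {K : Type*} [Field K] (Q : Polynomial K) :
    (Function.support fun c ↦ Q.rootMultiplicity c).Finite := by
  classical
  refine Q.roots.toFinset.finite_toSet.subset fun c hc ↦ ?_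
  simpa [← Multiset.count_ne_zero] using hc

theorem finsum_rootMultiplicity {K : Type*} [Field K] [IsAlgClosed K] (Q : Polynomial K) :
    ∑ᶠ c, Q.rootMultiplicity c = Q.natDegree := by
  classical
  rw [finsum_eq_sum_of_support_subset (s := Q.roots.toFinset) _ fun c hc ↦ by
    simpa [← Multiset.count_ne_zero] using hc]
  simp only [← Polynomial.count_roots]
  rw [Multiset.toFinset_sum_count_eq, IsAlgClosed.card_roots_eq_natDegree]

theorem injOn_jInv {R : Set ℍ} (hR : IsFundamentalSet R) : Set.InjOn jInv R := by
  intro P hP P' hP' h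
  obtain ⟨_, -, huniq⟩ := hR P
  exact (huniq P ⟨hP, MulAction.mem_orbit_self P⟩).trans
    (huniq P' ⟨hP', jInv_eq_iff.mp h.symm⟩).symm

theorem image_jInv_nonElliptic {R : Set ℍ} (hR : IsFundamentalSet R) :
    jInv '' nonElliptic R = {1728, 0}ᶜ := by
  ext c
  simp only [Set.mem_image, nonElliptic, Set.mem_ofPred_eq, ← jInv_eq_iff, jInv_I, jInv_ρ,
    Set.mem_compl_iff, Set.mem_insert_iff, Set.mem_singleton_iff, not_or]
  constructor
  · rintro ⟨P, ⟨-, hP⟩, rfl⟩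
    exact hP
  · intro hc
    obtain ⟨z, rfl⟩ := exists_jInv_eq c
    obtain ⟨P, ⟨hP, hPz⟩, -⟩ := hR z
    have hj := jInv_eq_iff.mpr hPz
    exact ⟨P, ⟨hP, by rwa [hj]⟩, hj⟩

/-- Since `j` identifies the orbits with `ℂ`, this counts the roots of `Q`. -/
theorem orbifoldDegree_rootMultiplicity_jInv {R : Set ℍ} (hR : IsFundamentalSet R)
    (Q : Polynomial ℂ) :
    orbifoldDegree R (fun z ↦ Q.rootMultiplicity (jInv z) * jRamification z) = Q.natDegree := by
  have hsum : ∑ᶠ P ∈ nonElliptic R,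
      ((Q.rootMultiplicity (jInv P) * jRamification P).toNat : ℚ) =
        ((∑ᶠ c ∈ ({1728, 0} : Set ℂ)ᶜ, Q.rootMultiplicity c : ℕ) : ℚ) := by
    rw [← Nat.coe_castAddMonoidHom, (Nat.castAddMonoidHom ℚ).map_finsum_mem'
        ((finite_support_rootMultiplicity Q).inter_of_right _), ← image_jInv_nonElliptic hR,
      finsum_mem_image ((injOn_jInv hR).mono fun P hP ↦ hP.1)]
    refine finsum_mem_congr rfl fun P hP ↦ ?_
    rw [jRamification_eq_one hP.2.1 hP.2.2, mul_one, ENat.toNat_natCast]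
  have hsplit := finsum_mem_add_sdiff' (f := fun c : ℂ ↦ Q.rootMultiplicity c)
    (s := {1728, 0}) (t := Set.univ) (Set.subset_univ _)
    (by simpa using finite_support_rootMultiplicity Q)
  rw [finsum_mem_univ, finsum_rootMultiplicity, finsum_mem_pair (by norm_num),
    ← Set.compl_eq_univ_sdiff] at hsplit
  rw [orbifoldDegree, hsum, jRamification_I, jRamification_ρ, jInv_I, jInv_ρ, ← hsplit]
  simp only [ENat.toNat_mul, ENat.toNat_natCast, ENat.toNat_ofNat]
  push_cast
  ring

theorem mdifferentiable_eval_jInv (Q : Polynomial ℂ) : MDiff (fun z ↦ Q.eval (jInv z)) :=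
  UpperHalfPlane.mdifferentiable_iff.mpr <|
    Q.differentiable.comp_differentiableOn
      (UpperHalfPlane.mdifferentiable_iff.mp mdifferentiable_jInv)

theorem ord_eval_jInv {Q : Polynomial ℂ} (hQ : Q ≠ 0) (z : ℍ) :
    ord (fun w ↦ Q.eval (jInv w)) z = Q.rootMultiplicity (jInv z) * jRamification z := by
  obtain ⟨Q₁, hQ₁, hdvd⟩ := Q.exists_eq_pow_rootMultiplicity_mul_and_not_dvd hQ (jInv z)
  rw [Polynomial.dvd_iff_isRoot] at hdvd
  set m := Q.rootMultiplicity (jInv z)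
  have hfactor : (fun w ↦ Q.eval (jInv w)) =
      (fun w ↦ jInv w - jInv z) ^ m * fun w ↦ Q₁.eval (jInv w) := by
    ext w
    simp [hQ₁]
  have hj := mdifferentiable_jInv_sub (jInv z)
  rw [hfactor, ord_mul_eq_left (hj.pow m) (mdifferentiable_eval_jInv Q₁) hdvd, ord_pow hj,
    jRamification]

theorem tendsto_discriminant_atImInfty : Tendsto discriminant atImInfty (𝓝 0) :=
  discriminant_isZeroAtImInfty

theorem exists_eq_discriminant_pow_mul_eval_jInv (M : ℕ) {k : ℤ} (hk : k = 12 * M)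
    (f : ModularForm 𝒮ℒ k) :
    ∃ Q : Polynomial ℂ, ∀ z, f z = discriminant z ^ M * Q.eval (jInv z) := by
  induction M generalizing k with
  | zero =>
    obtain rfl : k = 0 := by simpa using hk
    obtain ⟨c, hc⟩ := ModularFormClass.levelOne_weight_zero_const f
    exact ⟨Polynomial.C c, fun z ↦ by simp [hc]⟩
  | succ M ih =>
    set a := (qExpansion 1 f).coeff 0 with ha
    let E : ModularForm 𝒮ℒ k := (E₄.pow (3 * (M + 1))).mcast (by rw [hk]; push_cast; ring)
    have hE_apply (z : ℍ) : E z = E₄ z ^ (3 * (M + 1)) := by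
      simp only [E, coe_mcast, coe_pow, Pi.pow_apply]
    have hE : Tendsto E atImInfty (𝓝 1) := by
      simpa using (tendsto_E₄_atImInfty.pow (3 * (M + 1))).congr fun z ↦ (hE_apply z).symm
    have hsub : Tendsto (f - a • E : ModularForm 𝒮ℒ k) atImInfty (𝓝 0) := by
      have := (tendsto_levelOne_atImInfty f).sub (hE.const_mul a)
      rwa [mul_one, ← ha, sub_self] at this
    have hcusp : (qExpansion 1 (f - a • E : ModularForm 𝒮ℒ k)).coeff 0 = 0 :=
      tendsto_nhds_unique (tendsto_levelOne_atImInfty _) hsub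
    obtain ⟨Q, hQ⟩ := ih (k := k - 12) (by rw [hk]; push_cast; ring)
      (CuspForm.discriminantEquiv (toCuspForm _ hcusp))
    refine ⟨Q + Polynomial.C a * Polynomial.X ^ (M + 1), fun z ↦ ?_⟩
    have hz := hQ z
    rw [CuspForm.discriminantEquiv_apply, toCuspForm_apply,
      div_eq_iff (discriminant_ne_zero z)] at hz
    simp only [sub_apply, smul_apply, smul_eq_mul, hE_apply] at hz
    simp only [Polynomial.eval_add, Polynomial.eval_mul, Polynomial.eval_C,
      Polynomial.eval_pow, Polynomial.eval_X]
    have hj : (jInv z * discriminant z) ^ (M + 1) = E₄ z ^ (3 * (M + 1)) := by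
      rw [jInv_mul_discriminant, pow_mul]
    linear_combination hz - a * hj

theorem tendsto_jInv_mul_discriminant_atImInfty :
    Tendsto (fun z ↦ jInv z * discriminant z) atImInfty (𝓝 1) := by
  simpa only [jInv_mul_discriminant, one_pow] using tendsto_E₄_atImInfty.pow 3

theorem tendsto_eval_jInv_mul_discriminant_pow (Q : Polynomial ℂ) :
    Tendsto (fun z ↦ Q.eval (jInv z) * discriminant z ^ Q.natDegree) atImInfty
      (𝓝 Q.leadingCoeff) := by
  have hterm (i : ℕ) (hi : i ∈ Finset.range (Q.natDegree + 1)) :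
      Tendsto (fun z ↦ Q.coeff i * jInv z ^ i * discriminant z ^ Q.natDegree) atImInfty
        (𝓝 (Q.coeff i * (1 ^ i * 0 ^ (Q.natDegree - i)))) := by
    refine (((tendsto_jInv_mul_discriminant_atImInfty.pow i).mul
      (tendsto_discriminant_atImInfty.pow (Q.natDegree - i))).const_mul (Q.coeff i)).congr
      fun z ↦ ?_
    rw [mul_pow, mul_assoc, ← pow_add,
      Nat.add_sub_cancel' (Nat.lt_succ_iff.mp (Finset.mem_range.mp hi)), mul_assoc]
  have hsum := tendsto_finsetSum _ hterm
  simp only [← Finset.sum_mul, ← Polynomial.eval_eq_sum_range] at hsum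
  convert hsum
  rw [Finset.sum_range_succ, Finset.sum_eq_zero fun i hi ↦ ?_]
  · simp
  · rw [zero_pow (Nat.sub_ne_zero_of_lt (Finset.mem_range.mp hi)), mul_zero, mul_zero]

theorem eq_of_tendsto_discriminant_pow_div {a b : ℕ} {c : ℂ} (hc : c ≠ 0)
    (h : Tendsto (fun z ↦ discriminant z ^ a / discriminant z ^ b) atImInfty (𝓝 c)) : a = b := by
  have key {a b : ℕ} (hab : a < b) :
      Tendsto (fun z ↦ discriminant z ^ b / discriminant z ^ a) atImInfty (𝓝 0) := by
    have := tendsto_discriminant_atImInfty.pow (b - a)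
    rw [zero_pow (Nat.sub_ne_zero_of_lt hab)] at this
    exact this.congr fun z ↦ pow_sub₀ _ (discriminant_ne_zero z) hab.le
  rcases lt_trichotomy a b with hab | hab | hab
  · have := h.inv₀ hc
    simp only [inv_div] at this
    exact absurd (tendsto_nhds_unique this (key hab)) (inv_ne_zero hc)
  · exact hab
  · exact absurd (tendsto_nhds_unique h (key hab)) hc

theorem ne_zero_of_tendsto_div_discriminant_pow {f : ℍ → ℂ} {m : ℕ} {c : ℂ} (hc : c ≠ 0)
    (hf : Tendsto (fun z ↦ f z / discriminant z ^ m) atImInfty (𝓝 c)) : f ≠ 0 := by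
  rintro rfl
  exact hc (tendsto_nhds_unique hf (by simp))

theorem valence_formula_of_weight_eq {M : ℕ} {k : ℤ} (hk : k = 12 * M) (f : ModularForm 𝒮ℒ k)
    {m : ℕ} {c : ℂ} (hc : c ≠ 0)
    (hf : Tendsto (fun z ↦ f z / discriminant z ^ m) atImInfty (𝓝 c))
    {R : Set ℍ} (hR : IsFundamentalSet R) :
    {P | P ∈ R ∧ ord f P ≠ 0}.Finite ∧ m + orbifoldDegree R (ord f) = M := by
  obtain ⟨Q, hQ⟩ := exists_eq_discriminant_pow_mul_eval_jInv M hk f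
  have hQ0 : Q ≠ 0 := by
    rintro rfl
    exact ne_zero_of_tendsto_div_discriminant_pow hc hf (funext fun z ↦ by simp [hQ])
  have hord : ord f = fun z ↦ Q.rootMultiplicity (jInv z) * jRamification z := by
    have hfQ : (f : ℍ → ℂ) = (fun z ↦ Q.eval (jInv z)) * discriminant ^ M :=
      funext fun z ↦ (hQ z).trans (mul_comm _ _)
    ext1 z
    rw [hfQ, ord_mul_eq_left (mdifferentiable_eval_jInv Q) (mdifferentiable_discriminant.pow M)
      (pow_ne_zero _ (discriminant_ne_zero z)), ord_eval_jInv hQ0]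
  have hdeg : M = m + Q.natDegree := by
    refine eq_of_tendsto_discriminant_pow_div
      (div_ne_zero hc (Polynomial.leadingCoeff_ne_zero.mpr hQ0)) ((hf.div
        (tendsto_eval_jInv_mul_discriminant_pow Q)
        (Polynomial.leadingCoeff_ne_zero.mpr hQ0)).congr' ?_)
    have hne := (tendsto_eval_jInv_mul_discriminant_pow Q).eventually_ne
      (Polynomial.leadingCoeff_ne_zero.mpr hQ0)
    filter_upwards [hne] with z hz
    have hΔ := discriminant_ne_zero z
    have := left_ne_zero_of_mul hz
    simp only [Pi.div_apply, hQ, pow_add]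
    field_simp
  rw [hord, orbifoldDegree_rootMultiplicity_jInv hR, hdeg]
  refine ⟨.of_finite_image ((finite_support_rootMultiplicity Q).subset ?_)
    ((injOn_jInv hR).mono fun P hP ↦ hP.1), by push_cast; rfl⟩
  rintro _ ⟨P, ⟨-, hP⟩, rfl⟩
  exact fun h ↦ hP (by simp [show Q.rootMultiplicity (jInv P) = 0 from h])

/-- The hypothesis `hf` says that `f` vanishes to order `m` at the cusp, where `Δ` has a simple
zero. -/
theorem valence_formula {k : ℤ} (f : ModularForm 𝒮ℒ k) {m : ℕ} {c : ℂ} (hc : c ≠ 0)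
    (hf : Tendsto (fun z ↦ f z / discriminant z ^ m) atImInfty (𝓝 c))
    {R : Set ℍ} (hR : IsFundamentalSet R) :
    {P | P ∈ R ∧ ord f P ≠ 0}.Finite ∧ m + orbifoldDegree R (ord f) = k / 12 := by
  have hf0 := ne_zero_of_tendsto_div_discriminant_pow hc hf
  lift k to ℕ using not_lt.mp fun hk ↦
    hf0 (ModularFormClass.levelOne_neg_weight_eq_zero hk f)
  have hord : ord (f.pow 12) = fun z ↦ ((12 : ℕ) : ℕ∞) * ord f z :=
    funext fun z ↦ by rw [coe_pow]; exact ord_pow f.holo' 12 z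
  obtain ⟨hfin, hdeg⟩ := valence_formula_of_weight_eq (M := k) (by simp) (f.pow 12)
    (m := 12 * m) (pow_ne_zero 12 hc) ((hf.pow 12).congr fun z ↦ by
      rw [coe_pow, Pi.pow_apply, div_pow, ← pow_mul, mul_comm m]) hR
  rw [hord] at hfin hdeg
  rw [orbifoldDegree_nat_mul] at hdeg
  refine ⟨by simpa using hfin, ?_⟩
  push_cast at hdeg ⊢
  linarith

end Valence

end ValenceFormula

/-! ### Finite orbits of parameters -/

section Orbits

open scoped Pointwise

theorem half_add_half : half + half = 0 := by
  rw [half, ← AddCircle.coe_add, add_halves, AddCircle.coe_period]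

theorem neg_half : -half = half := neg_eq_of_add_eq_zero_left half_add_half

theorem coe_eq_coe_iff_exists {s t : ℝ} :
    (s : UnitAddCircle) = t ↔ ∃ k : ℤ, s = t + k := by
  simp only [← sub_eq_zero (a := (s : UnitAddCircle)), ← AddCircle.coe_sub,
    AddCircle.coe_eq_zero_iff, zsmul_eq_mul, mul_one, eq_comm (b := s - t), sub_eq_iff_eq_add']

/-- The representative in `(-1/2, 1/2]` of a class modulo 1. -/
def centeredRep (a : UnitAddCircle) : ℝ := (AddCircle.equivIoc (1 : ℝ) (-1 / 2) a : ℝ)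

theorem coe_centeredRep (a : UnitAddCircle) : (centeredRep a : UnitAddCircle) = a :=
  AddCircle.coe_equivIoc

theorem centeredRep_mem (a : UnitAddCircle) : centeredRep a ∈ Set.Ioc (-1 / 2 : ℝ) (1 / 2) := by
  have hmem := (AddCircle.equivIoc (1 : ℝ) (-1 / 2) a).2
  exact ⟨hmem.1, hmem.2.trans (by norm_num)⟩

theorem centeredRep_coe {t : ℝ} (ht : t ∈ Set.Ioc (-1 / 2 : ℝ) (1 / 2)) :
    centeredRep (t : UnitAddCircle) = t :=
  AddCircle.equivIoc_coe_of_mem ⟨ht.1, ht.2.trans (by norm_num)⟩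

theorem centeredRep_injective : Function.Injective centeredRep :=
  Function.LeftInverse.injective (g := ((↑) : ℝ → UnitAddCircle)) coe_centeredRep

theorem centeredRep_half : centeredRep half = 1 / 2 :=
  centeredRep_coe ⟨by norm_num, le_rfl⟩

theorem centeredRep_zero : centeredRep 0 = 0 := by
  simpa using centeredRep_coe (t := 0) ⟨by norm_num, by norm_num⟩

theorem centeredRep_lt_half {a : UnitAddCircle} (ha : a ≠ half) : centeredRep a < 1 / 2 :=
  (centeredRep_mem a).2.lt_of_ne fun h ↦ ha (centeredRep_injective (h.trans centeredRep_half.symm))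

theorem centeredRep_neg {a : UnitAddCircle} (ha : a ≠ half) :
    centeredRep (-a) = -centeredRep a := by
  have hlt := centeredRep_lt_half ha
  have hmem := centeredRep_mem a
  rw [← coe_centeredRep a, ← AddCircle.coe_neg, coe_centeredRep]
  exact centeredRep_coe ⟨by linarith, by linarith [hmem.1]⟩

theorem centeredRep_neg_sq (a : UnitAddCircle) : centeredRep (-a) ^ 2 = centeredRep a ^ 2 := by
  by_cases ha : a = half
  · rw [ha, neg_half]
  · rw [centeredRep_neg ha, neg_sq]

theorem eq_zero_or_half_of_neg_eq {a : UnitAddCircle} (h : -a = a) : a = 0 ∨ a = half := by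
  refine or_iff_not_imp_right.mpr fun ha ↦ centeredRep_injective ?_
  have hneg := centeredRep_neg ha
  rw [h] at hneg
  rw [centeredRep_zero]
  linarith

/-- The odd sawtooth function: the representative in `(-1/2, 1/2)`, and `0` at `1/2`. -/
def sawtooth (a : UnitAddCircle) : ℝ :=
  open Classical in if a = half then 0 else centeredRep a

theorem sawtooth_half : sawtooth half = 0 := if_pos rfl

theorem sawtooth_of_ne_half {a : UnitAddCircle} (ha : a ≠ half) : sawtooth a = centeredRep a :=
  if_neg ha

theorem sawtooth_neg (a : UnitAddCircle) : sawtooth (-a) = -sawtooth a := by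
  by_cases ha : a = half
  · rw [ha, neg_half, sawtooth_half, neg_zero]
  · have hna : -a ≠ half := fun h ↦ ha (by rw [← neg_neg a, h, neg_half])
    rw [sawtooth_of_ne_half ha, sawtooth_of_ne_half hna, centeredRep_neg ha]

theorem sq_centeredRep_add_add {a b c : UnitAddCircle} (h : a + b + c = half) (ha : a ≠ half)
    (hb : b ≠ half) (hc : c ≠ half) :
    (centeredRep a + centeredRep b + centeredRep c) ^ 2 = 1 / 4 := by
  obtain ⟨k, hk⟩ : ∃ k : ℤ, centeredRep a + centeredRep b + centeredRep c = 1 / 2 + k := by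
    rw [← coe_eq_coe_iff_exists, AddCircle.coe_add, AddCircle.coe_add, coe_centeredRep,
      coe_centeredRep, coe_centeredRep, h, half]
  have hlb : (-2 : ℝ) < k := by
    linarith [(centeredRep_mem a).1, (centeredRep_mem b).1, (centeredRep_mem c).1]
  have hub : (k : ℝ) < 1 := by
    linarith [centeredRep_lt_half ha, centeredRep_lt_half hb, centeredRep_lt_half hc]
  obtain rfl | rfl : k = 0 ∨ k = -1 := by
    have : -2 < k := by exact_mod_cast hlb
    have : k < 1 := by exact_mod_cast hub
    omega
  all_goals
    rw [hk]
    norm_num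

theorem sawtooth_identity_of_half {b c : UnitAddCircle} (h : b + c = 0) (hb : b ≠ half) :
    centeredRep half ^ 2 + centeredRep b ^ 2 + centeredRep c ^ 2 +
      2 * (sawtooth half * sawtooth b + sawtooth b * sawtooth c + sawtooth c * sawtooth half) =
      1 / 4 := by
  rw [eq_neg_of_add_eq_zero_right h, centeredRep_neg_sq, sawtooth_neg, sawtooth_half,
    sawtooth_of_ne_half hb, centeredRep_half]
  ring

theorem sawtooth_identity {a b c : UnitAddCircle} (h : a + b + c = half)
    (hne : ¬(a = half ∧ b = half)) :
    centeredRep a ^ 2 + centeredRep b ^ 2 + centeredRep c ^ 2 +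
      2 * (sawtooth a * sawtooth b + sawtooth b * sawtooth c + sawtooth c * sawtooth a) =
      1 / 4 := by
  by_cases ha : a = half
  · subst ha
    exact sawtooth_identity_of_half (by simpa [add_assoc] using h) fun hb ↦ hne ⟨rfl, hb⟩
  by_cases hb : b = half
  · subst hb
    have hac : a + c = 0 := by simpa [add_right_comm a half] using h
    linear_combination sawtooth_identity_of_half hac ha
  by_cases hc : c = half
  · subst hc
    linear_combination sawtooth_identity_of_half (by simpa using h) ha
  rw [sawtooth_of_ne_half ha, sawtooth_of_ne_half hb, sawtooth_of_ne_half hc]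
  linear_combination sq_centeredRep_add_add h ha hb hc

theorem smul_mem_paramOrbit (g : Subgroup.closure {permS, permT}) {x y : Param} :
    g • y ∈ paramOrbit x ↔ y ∈ paramOrbit x := by
  rw [paramOrbit, ← MulAction.orbit_eq_iff, MulAction.orbit_smul, MulAction.orbit_eq_iff]

theorem permS_mem_paramOrbit {x y : Param} : permS y ∈ paramOrbit x ↔ y ∈ paramOrbit x :=
  smul_mem_paramOrbit ⟨permS, Subgroup.subset_closure (by simp)⟩

theorem permT_mem_paramOrbit {x y : Param} : permT y ∈ paramOrbit x ↔ y ∈ paramOrbit x :=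
  smul_mem_paramOrbit ⟨permT, Subgroup.subset_closure (by simp)⟩

theorem paramOrbit_eq_of_mem {x y : Param} (h : y ∈ paramOrbit x) :
    paramOrbit y = paramOrbit x :=
  MulAction.orbit_eq_iff.mpr h

theorem paramOrbit_subset {A : Set Param} (hS : permS • A = A) (hT : permT • A = A) {x : Param}
    (hx : x ∈ A) : paramOrbit x ⊆ A := by
  have hle : Subgroup.closure {permS, permT} ≤ MulAction.stabilizer (Equiv.Perm Param) A := by
    rw [Subgroup.closure_le]
    rintro g (rfl | rfl)
    exacts [hS, hT]
  rintro _ ⟨g, rfl⟩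
  have hg : g.1 • A = A := hle g.2
  rw [← hg]
  exact Set.smul_mem_smul_set hx

theorem paramOrbit_half_half : paramOrbit (half, half) = {(half, half)} := by
  refine (paramOrbit_subset ?_ ?_ (Set.mem_singleton _)).antisymm
    (Set.singleton_subset_iff.mpr (MulAction.mem_orbit_self _))
  · simp [permS, neg_half]
  · simp [permT, half_add_half]

theorem paramOrbit_zero_zero : paramOrbit (0, 0) = {(0, 0), (half, 0), (0, half)} := by
  refine (paramOrbit_subset ?_ ?_ (by simp)).antisymm ?_
  · simp [Set.smul_set_insert, permS, neg_half, Set.pair_comm]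
  · have hT : permT • ({(0, 0), (half, 0), (0, half)} : Set Param) =
        {(0, half), (half, 0), (0, 0)} := by
      simp [Set.smul_set_insert, permT, half_add_half]
    grind
  · have h0 : (0, 0) ∈ paramOrbit (0, 0) := MulAction.mem_orbit_self _
    have h2 : (0, half) ∈ paramOrbit (0, 0) := by
      simpa [permT] using permT_mem_paramOrbit.mpr h0
    have h1 : (half, 0) ∈ paramOrbit (0, 0) := by
      simpa [permS, neg_half] using permS_mem_paramOrbit.mpr h2
    rintro _ (rfl | rfl | rfl) <;> assumption

theorem half_half_notMem {x : Param} (h : paramOrbit x ≠ {(half, half)}) :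
    (half, half) ∉ paramOrbit x :=
  fun hmem ↦ h (paramOrbit_eq_of_mem hmem ▸ paramOrbit_half_half)

theorem notMem_paramOrbit_zero_zero {x : Param}
    (h : paramOrbit x ≠ {(0, 0), (half, 0), (0, half)}) {y : Param} (hy : y ∈ paramOrbit x) :
    y ∉ paramOrbit (0, 0) := fun hmem ↦
  h (by rw [← paramOrbit_eq_of_mem hy, paramOrbit_eq_of_mem hmem, paramOrbit_zero_zero])

theorem neg_ne_self_of_mem_paramOrbit {x : Param} (h₁ : paramOrbit x ≠ {(half, half)})
    (h₂ : paramOrbit x ≠ {(0, 0), (half, 0), (0, half)}) {y : Param} (hy : y ∈ paramOrbit x) :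
    -y ≠ y := by
  intro hneg
  have hne := notMem_paramOrbit_zero_zero h₂ hy
  obtain ⟨a, b⟩ := y
  obtain rfl | rfl := eq_zero_or_half_of_neg_eq (congrArg Prod.fst hneg) <;>
  obtain rfl | rfl := eq_zero_or_half_of_neg_eq (congrArg Prod.snd hneg)
  · exact hne (by simp [paramOrbit_zero_zero])
  · exact hne (by simp [paramOrbit_zero_zero])
  · exact hne (by simp [paramOrbit_zero_zero])
  · exact half_half_notMem h₁ hy

theorem even_ncard_paramOrbit {x : Param} (hfin : (paramOrbit x).Finite)
    (h₁ : paramOrbit x ≠ {(half, half)})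
    (h₂ : paramOrbit x ≠ {(0, 0), (half, 0), (0, half)}) : Even (paramOrbit x).ncard := by
  have hsum : ∑ _ ∈ hfin.toFinset, (1 : ZMod 2) = 0 := by
    refine Finset.sum_involution (fun y _ ↦ permS (permS y)) (fun _ _ ↦ by decide)
      (fun y hy _ ↦ ?_) (fun y hy ↦ ?_) fun y _ ↦ by simp [permS]
    · exact neg_ne_self_of_mem_paramOrbit h₁ h₂ (hfin.mem_toFinset.mp hy)
    · simpa only [Set.Finite.mem_toFinset, permS_mem_paramOrbit] using hy
  rw [Set.ncard_eq_toFinset_card _ hfin, ← ZMod.natCast_eq_zero_iff_even]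
  simpa using hsum

@[to_additive]
theorem prod_paramOrbit_permS {M : Type*} [CommMonoid M] {x : Param}
    (hfin : (paramOrbit x).Finite) (f : Param → M) :
    ∏ y ∈ hfin.toFinset, f (permS y) = ∏ y ∈ hfin.toFinset, f y :=
  Finset.prod_equiv permS (by simp [permS_mem_paramOrbit]) (fun _ _ ↦ rfl)

@[to_additive]
theorem prod_paramOrbit_permT {M : Type*} [CommMonoid M] {x : Param}
    (hfin : (paramOrbit x).Finite) (f : Param → M) :
    ∏ y ∈ hfin.toFinset, f (permT y) = ∏ y ∈ hfin.toFinset, f y :=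
  Finset.prod_equiv permT (by simp [permT_mem_paramOrbit]) (fun _ _ ↦ rfl)

theorem sum_paramOrbit_rotate {M : Type*} [AddCommMonoid M] {x : Param}
    (hfin : (paramOrbit x).Finite) (f : Param → M) :
    ∑ y ∈ hfin.toFinset, f (half - y.1 - y.2, y.1) = ∑ y ∈ hfin.toFinset, f y := by
  rw [← sum_paramOrbit_permS hfin f, ← sum_paramOrbit_permT hfin fun y ↦ f (permS y)]
  refine Finset.sum_congr rfl fun y _ ↦ ?_
  congr 2
  simp only [permT, Equiv.coe_fn_mk, neg_add, neg_half]
  abel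

theorem sum_sawtooth_mul_sawtooth {x : Param} (hfin : (paramOrbit x).Finite) :
    ∑ y ∈ hfin.toFinset, sawtooth y.1 * sawtooth y.2 = 0 := by
  have hneg := sum_paramOrbit_permS hfin fun y ↦ sawtooth y.1 * sawtooth y.2
  simp only [permS, Equiv.coe_fn_mk, sawtooth_neg, neg_mul, Finset.sum_neg_distrib,
    mul_comm (sawtooth (Prod.snd _))] at hneg
  linarith

-- The three classes `a`, `b` and `1/2 - a - b` are permuted cyclically by an element of the group,
-- so their squares have equal sums over the orbit, and so do their pairwise products.
theorem sum_centeredRep_sq {x : Param} (hfin : (paramOrbit x).Finite)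
    (h : paramOrbit x ≠ {(half, half)}) :
    ∑ y ∈ hfin.toFinset, centeredRep y.1 ^ 2 = (paramOrbit x).ncard / 12 := by
  have hsq := sum_paramOrbit_rotate hfin fun y ↦ centeredRep y.1 ^ 2
  have hsq' := sum_paramOrbit_rotate hfin fun y ↦ centeredRep y.2 ^ 2
  have hmul := sum_paramOrbit_rotate hfin fun y ↦ sawtooth y.1 * sawtooth y.2
  have hmul' := sum_paramOrbit_rotate hfin fun y ↦ sawtooth y.2 * sawtooth (half - y.1 - y.2)
  have hrot (y : Param) : half - (half - y.1 - y.2) - y.1 = y.2 := by abel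
  simp only [hrot] at hsq hsq' hmul hmul'
  have hzero := sum_sawtooth_mul_sawtooth hfin
  have htot := Finset.sum_congr rfl fun y (hy : y ∈ hfin.toFinset) ↦
    sawtooth_identity (add_sub_cancel (y.1 + y.2) half) fun hhalf ↦ half_half_notMem h
      ((Prod.ext hhalf.1 hhalf.2 : y = (half, half)) ▸ hfin.mem_toFinset.mp hy)
  simp only [← sub_sub, Finset.sum_add_distrib, ← Finset.mul_sum, Finset.sum_const,
    nsmul_eq_mul] at htot
  rw [Set.ncard_eq_toFinset_card _ hfin]
  linarith

end Orbits

/-! ### The derivatives of the theta functions -/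

section Theta

open Filter Topology Complex
open scoped Real UpperHalfPlane

theorem differentiableAt_jacobiTheta₂'_comp {f : ℂ → ℂ} (hf : Differentiable ℂ f) {τ : ℂ}
    (hτ : 0 < im τ) : DifferentiableAt ℂ (fun w ↦ jacobiTheta₂' (f w) w) τ := by
  obtain ⟨T, hT, hτ'⟩ := exists_between hτ
  obtain ⟨S, hS⟩ := exists_gt |im (f τ)|
  have hU : IsOpen {w : ℂ | T < im w ∧ |im (f w)| < S} :=
    (isOpen_lt continuous_const continuous_im).inter
      (isOpen_lt (continuous_abs.comp (continuous_im.comp hf.continuous)) continuous_const)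
  refine (differentiableOn_tsum_of_summable_norm
    (u := fun n : ℤ ↦ 2 * π * |n| * Real.exp (-π * (T * n ^ 2 - 2 * S * |n|))) ?_ ?_ hU
    fun n w hw ↦ norm_jacobiTheta₂'_term_le hT hw.2.le hw.1.le n).differentiableAt
    (hU.mem_nhds ⟨hτ', hS⟩)
  · simpa only [pow_one, mul_assoc] using
      (summable_pow_mul_jacobiTheta₂_term_bound S hT 1).mul_left (2 * π)
  · intro n
    unfold jacobiTheta₂'_term jacobiTheta₂_term
    fun_prop

theorem thetaChar_eq_jacobiTheta₂ (p q τ : ℂ) :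
    thetaChar p q 0 τ =
      cexp (π * I * p ^ 2 * τ + 2 * π * I * p * q) * jacobiTheta₂ (p * τ + q) τ := by
  rw [thetaChar, jacobiTheta₂, ← tsum_mul_left]
  refine tsum_congr fun m ↦ ?_
  rw [jacobiTheta₂_term, ← Complex.exp_add]
  congr 1
  ring

theorem dqTheta_eq_jacobiTheta₂ (p q : ℂ) {τ : ℂ} (hτ : 0 < im τ) :
    dqTheta p q τ = cexp (π * I * p ^ 2 * τ + 2 * π * I * p * q) *
      (2 * π * I * p * jacobiTheta₂ (p * τ + q) τ + jacobiTheta₂' (p * τ + q) τ) := by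
  have h1 : HasDerivAt (fun q' : ℂ ↦ cexp (π * I * p ^ 2 * τ + 2 * π * I * p * q'))
      (cexp (π * I * p ^ 2 * τ + 2 * π * I * p * q) * (2 * π * I * p)) q := by
    simpa using (((hasDerivAt_id q).const_mul (2 * π * I * p)).const_add
      (π * I * p ^ 2 * τ)).cexp
  have h2 : HasDerivAt (fun q' : ℂ ↦ jacobiTheta₂ (p * τ + q') τ)
      (jacobiTheta₂' (p * τ + q) τ) q :=
    (hasDerivAt_jacobiTheta₂_fst (p * τ + q) hτ).comp_const_add (p * τ) q
  rw [dqTheta, funext fun q' ↦ thetaChar_eq_jacobiTheta₂ p q' τ, (h1.fun_mul h2).deriv]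
  ring

/-- The coefficient of `exp (π i (m + p)² τ)` in the expansion of `∂_q ϑ[p,q](τ)` at `i∞`. -/
def dqThetaCoeff (p q : ℂ) (m : ℤ) : ℂ :=
  2 * π * I * (m + p) * cexp (2 * π * I * (m + p) * q)

theorem hasSum_dqTheta (p q : ℂ) {τ : ℂ} (hτ : 0 < im τ) :
    HasSum (fun m : ℤ ↦ dqThetaCoeff p q m * cexp (π * I * (m + p) ^ 2 * τ)) (dqTheta p q τ) := by
  rw [dqTheta_eq_jacobiTheta₂ p q hτ]
  refine ((((hasSum_jacobiTheta₂_term (p * τ + q) hτ).mul_left (2 * π * I * p)).add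
    (hasSum_jacobiTheta₂'_term (p * τ + q) hτ)).mul_left _).congr_fun fun m ↦ ?_
  have hexp : cexp (2 * π * I * (m + p) * q) * cexp (π * I * (m + p) ^ 2 * τ) =
      cexp (π * I * p ^ 2 * τ + 2 * π * I * p * q) * jacobiTheta₂_term m (p * τ + q) τ := by
    rw [jacobiTheta₂_term, ← Complex.exp_add, ← Complex.exp_add]
    ring_nf
  rw [dqThetaCoeff, mul_assoc _ (cexp _), hexp, jacobiTheta₂'_term]
  ring

theorem analyticAt_dqTheta (p q : ℂ) {τ : ℂ} (hτ : 0 < im τ) : AnalyticAt ℂ (dqTheta p q) τ := by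
  have hopen : IsOpen {w : ℂ | 0 < im w} := isOpen_lt continuous_const continuous_im
  refine DifferentiableOn.analyticAt (s := {w : ℂ | 0 < im w}) (fun w hw ↦ ?_)
    (hopen.mem_nhds hτ)
  refine DifferentiableAt.differentiableWithinAt (DifferentiableAt.congr_of_eventuallyEq ?_
    (f := fun w ↦ cexp (π * I * p ^ 2 * w + 2 * π * I * p * q) *
      (2 * π * I * p * jacobiTheta₂ (p * w + q) w + jacobiTheta₂' (p * w + q) w))
    ((hopen.eventually_mem hw).mono fun w' hw' ↦ dqTheta_eq_jacobiTheta₂ p q hw'))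
  have h1 : DifferentiableAt ℂ (fun w ↦ jacobiTheta₂ (p * w + q) w) w :=
    (hasFDerivAt_jacobiTheta₂ (p * w + q) hw).differentiableAt.comp w
      (f := fun w ↦ (p * w + q, w)) (by fun_prop)
  have h2 : DifferentiableAt ℂ (fun w ↦ jacobiTheta₂' (p * w + q) w) w :=
    differentiableAt_jacobiTheta₂'_comp (by fun_prop) hw
  fun_prop

theorem dqTheta_add_intCast_left (p q τ : ℂ) (k : ℤ) :
    dqTheta (p + k) q τ = dqTheta p q τ := by
  have (q' : ℂ) : thetaChar (p + k) q' 0 τ = thetaChar p q' 0 τ := by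
    rw [thetaChar, thetaChar,
      ← (Equiv.addRight k).tsum_eq fun m : ℤ ↦ cexp (_ * (m + p) ^ 2 * _ + _)]
    refine tsum_congr fun m ↦ ?_
    simp only [Equiv.coe_addRight, Int.cast_add]
    congr 1
    ring
  simp only [dqTheta, this]

theorem dqTheta_add_intCast_right (p q τ : ℂ) (k : ℤ) :
    dqTheta p (q + k) τ = cexp (2 * π * I * p * k) * dqTheta p q τ := by
  have (q' : ℂ) : thetaChar p (q' + k) 0 τ =
      cexp (2 * π * I * p * k) * thetaChar p q' 0 τ := by
    rw [thetaChar, thetaChar, ← tsum_mul_left]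
    refine tsum_congr fun m ↦ ?_
    rw [← Complex.exp_add, Complex.exp_eq_exp_iff_exists_int]
    exact ⟨m * k, by push_cast; ring⟩
  rw [dqTheta, dqTheta, ← deriv_comp_add_const]
  simp only [this, deriv_const_mul_field]

theorem dqTheta_add_one (p q τ : ℂ) :
    dqTheta p q (τ + 1) = cexp (-π * I * (p ^ 2 + p)) * dqTheta p (q + p + 1 / 2) τ := by
  have (q' : ℂ) : thetaChar p q' 0 (τ + 1) =
      cexp (-π * I * (p ^ 2 + p)) * thetaChar p (q' + (p + 1 / 2)) 0 τ := by
    rw [thetaChar, thetaChar, ← tsum_mul_left]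
    refine tsum_congr fun m ↦ ?_
    rw [← Complex.exp_add, Complex.exp_eq_exp_iff_exists_int]
    obtain ⟨k, hk⟩ := Int.even_mul_pred_self m
    refine ⟨k, ?_⟩
    have hk' : (m : ℂ) * (m - 1) = k + k := by exact_mod_cast hk
    linear_combination (π * I) * hk'
  rw [add_assoc, dqTheta, dqTheta, ← deriv_comp_add_const]
  simp only [this, deriv_const_mul_field]

theorem dqTheta_neg_inv (p q : ℂ) {τ : ℂ} (hτ : 0 < im τ) :
    dqTheta p q (-1 / τ) =
      cexp (2 * π * I * p * q) * (τ * (-I * τ) ^ (1 / 2 : ℂ)) * dqTheta q (-p) τ := by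
  have hτ0 : τ ≠ 0 := by rintro rfl; simp at hτ
  have hτ' : 0 < im (-1 / τ) := by
    rw [neg_div, neg_im, one_div, inv_im, neg_div, neg_neg]
    exact div_pos hτ (normSq_pos.mpr hτ0)
  have hs : (-I * τ) ^ (1 / 2 : ℂ) ≠ 0 := by
    rw [Ne, cpow_eq_zero_iff]
    simp [hτ0]
  rw [dqTheta_eq_jacobiTheta₂ p q hτ', dqTheta_eq_jacobiTheta₂ q (-p) hτ,
    jacobiTheta₂'_functional_equation (q * τ + -p) τ,
    jacobiTheta₂_functional_equation (q * τ + -p) τ,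
    show p * (-1 / τ) + q = (q * τ + -p) / τ by field_simp; ring]
  have he : cexp (π * I * p ^ 2 * (-1 / τ) + 2 * π * I * p * q) =
      cexp (2 * π * I * p * q) * cexp (π * I * q ^ 2 * τ + 2 * π * I * q * -p) *
        cexp (-π * I * (q * τ + -p) ^ 2 / τ) := by
    rw [← Complex.exp_add, ← Complex.exp_add]
    congr 1
    field_simp
    ring
  rw [he]
  field_simp [hs]
  ring

theorem exists_dqThetaAt_eq {p q : ℝ} {x : Param} (hp : (p : UnitAddCircle) = x.1)
    (hq : (q : UnitAddCircle) = x.2) :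
    ∃ u : ℂ, u ≠ 0 ∧ ∀ τ, dqThetaAt x τ = u * dqTheta p q τ := by
  have hrep (a : UnitAddCircle) : (rep a : UnitAddCircle) = a := AddCircle.coe_equivIco
  obtain ⟨k, hk⟩ := coe_eq_coe_iff_exists.mp ((hrep x.1).trans hp.symm)
  obtain ⟨l, hl⟩ := coe_eq_coe_iff_exists.mp ((hrep x.2).trans hq.symm)
  refine ⟨cexp (2 * π * I * p * l), Complex.exp_ne_zero _, fun τ ↦ ?_⟩
  rw [dqThetaAt, hk, hl]
  push_cast
  rw [dqTheta_add_intCast_left, dqTheta_add_intCast_right]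

theorem exists_dqThetaAt_add_one (x : Param) :
    ∃ u : ℂ, ∀ τ, dqThetaAt x (τ + 1) = u * dqThetaAt (permT x) τ := by
  have h1 := coe_centeredRep x.1
  have h2 := coe_centeredRep x.2
  obtain ⟨u, -, hxu⟩ := exists_dqThetaAt_eq h1 h2
  obtain ⟨v, hv, hxv⟩ := exists_dqThetaAt_eq (x := permT x) (p := centeredRep x.1)
    (q := centeredRep x.2 + centeredRep x.1 + 1 / 2) h1
    (by simp only [AddCircle.coe_add, h1, h2]; rfl)
  refine ⟨u * cexp (-π * I * ((centeredRep x.1 : ℂ) ^ 2 + centeredRep x.1)) / v,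
    fun τ ↦ ?_⟩
  rw [hxu, hxv, dqTheta_add_one]
  push_cast
  field_simp

theorem exists_dqThetaAt_permS_neg_inv (x : Param) :
    ∃ u : ℂ, ∀ τ : ℂ, 0 < im τ → dqThetaAt (permS x) (-1 / τ) =
      u * (τ * (-I * τ) ^ (1 / 2 : ℂ)) * dqThetaAt x τ := by
  have h1 := coe_centeredRep x.1
  have h2 := coe_centeredRep x.2
  obtain ⟨u, -, hxu⟩ := exists_dqThetaAt_eq (x := permS x) (p := -centeredRep x.2)
    (q := centeredRep x.1) (by rw [AddCircle.coe_neg, h2]; rfl) h1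
  obtain ⟨v, hv, hxv⟩ := exists_dqThetaAt_eq h1 h2
  refine ⟨u * cexp (2 * π * I * -centeredRep x.2 * centeredRep x.1) / v, fun τ hτ ↦ ?_⟩
  rw [hxu, hxv, ofReal_neg, dqTheta_neg_inv _ _ hτ, neg_neg]
  field_simp

theorem analyticAt_dqThetaAt (x : Param) (τ : ℍ) : AnalyticAt ℂ (dqThetaAt x) τ :=
  analyticAt_dqTheta _ _ τ.im_pos

theorem norm_cexp_pi_mul_I_mul (s : ℝ) (τ : ℂ) :
    ‖cexp (π * I * s * τ)‖ = Real.exp (-(π * s * τ.im)) := by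
  rw [Complex.norm_exp, show (π : ℂ) * I * s * τ = ((π * s : ℝ) : ℂ) * (I * τ) by push_cast; ring,
    re_ofReal_mul, I_mul_re, mul_neg]

theorem hasSum_dqTheta_mul_cexp (p q μ : ℝ) {τ : ℂ} (hτ : 0 < im τ) :
    HasSum (fun m : ℤ ↦ dqThetaCoeff p q m * cexp (π * I * ((m + p) ^ 2 - μ : ℝ) * τ))
      (dqTheta p q τ * cexp (-π * I * μ * τ)) := by
  refine ((hasSum_dqTheta p q hτ).mul_right (cexp (-π * I * μ * τ))).congr_fun fun m ↦ ?_
  rw [mul_assoc (dqThetaCoeff p q m) (cexp _), ← Complex.exp_add]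
  push_cast
  ring_nf

theorem tendsto_cexp_pi_mul_I_mul {s : ℝ} (hs : 0 < s) :
    Tendsto (fun τ : ℍ ↦ cexp (π * I * s * τ)) UpperHalfPlane.atImInfty (𝓝 0) := by
  simp only [tendsto_zero_iff_norm_tendsto_zero (E := ℂ), norm_cexp_pi_mul_I_mul]
  exact Real.tendsto_exp_neg_atTop_nhds_zero.comp
    (tendsto_comap.const_mul_atTop (mul_pos Real.pi_pos hs))

theorem tendsto_dqTheta_mul_cexp {p μ : ℝ} (q : ℝ) {s : Finset ℤ}
    (hs : ∀ m ∈ s, (m + p) ^ 2 = μ) (hs' : ∀ m ∉ s, m + p = 0 ∨ μ < (m + p) ^ 2) :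
    Tendsto (fun τ : ℍ ↦ dqTheta p q τ * cexp (-π * I * μ * τ)) UpperHalfPlane.atImInfty
      (𝓝 (∑ m ∈ s, dqThetaCoeff p q m)) := by
  have hzero {m : ℤ} (hm : m + p = 0) : dqThetaCoeff p q m = 0 := by
    have hm' : (m + p : ℂ) = 0 := by exact_mod_cast hm
    simp [dqThetaCoeff, hm']
  have hsum (τ : ℍ) := hasSum_dqTheta_mul_cexp p q μ τ.im_pos
  have hlim (m : ℤ) : Tendsto
      (fun τ : ℍ ↦ dqThetaCoeff p q m * cexp (π * I * ((m + p) ^ 2 - μ : ℝ) * τ))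
      UpperHalfPlane.atImInfty (𝓝 (if m ∈ s then dqThetaCoeff p q m else 0)) := by
    split_ifs with hm
    · simp [hs m hm]
    obtain h0 | hlt := hs' m hm
    · simp [hzero h0]
    · simpa using (tendsto_cexp_pi_mul_I_mul (sub_pos.mpr hlt)).const_mul (dqThetaCoeff p q m)
  have hbound : ∀ᶠ τ : ℍ in UpperHalfPlane.atImInfty, ∀ m : ℤ,
      ‖dqThetaCoeff p q m * cexp (π * I * ((m + p) ^ 2 - μ : ℝ) * τ)‖ ≤
        ‖dqThetaCoeff p q m * cexp (π * I * ((m + p) ^ 2 - μ : ℝ) * UpperHalfPlane.I)‖ := by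
    filter_upwards [(tendsto_comap (f := UpperHalfPlane.im)).eventually_ge_atTop 1] with τ hτ m
    by_cases h0 : m + p = 0
    · simp [hzero h0]
    have hnonneg : 0 ≤ π * ((m + p) ^ 2 - μ) := by
      refine mul_nonneg Real.pi_pos.le (sub_nonneg.mpr ?_)
      by_cases hm : m ∈ s
      exacts [(hs m hm).ge, ((hs' m hm).resolve_left h0).le]
    rw [norm_mul, norm_mul, norm_cexp_pi_mul_I_mul, norm_cexp_pi_mul_I_mul]
    gcongr
    simpa using hτ
  have hdom := tendsto_tsum_of_dominated_convergence (hsum UpperHalfPlane.I).summable.norm hlim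
    hbound
  rw [tsum_eq_sum (s := s) fun m hm ↦ if_neg hm, Finset.sum_ite_mem, Finset.inter_self] at hdom
  exact hdom.congr fun τ ↦ (hsum τ).tsum_eq

theorem tendsto_dqTheta_of_abs_lt_half {p : ℝ} (hp : |p| < 1 / 2) (q : ℝ) :
    Tendsto (fun τ : ℍ ↦ dqTheta p q τ * cexp (-π * I * (p ^ 2 : ℝ) * τ)) UpperHalfPlane.atImInfty
      (𝓝 (dqThetaCoeff p q 0)) := by
  have hlim := tendsto_dqTheta_mul_cexp (p := p) (μ := p ^ 2) q (s := {0}) (by simp) fun m hm ↦ by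
    have hm0 : m ≠ 0 := by simpa using hm
    have hm1 : (1 : ℝ) ≤ |(m : ℝ)| := by exact_mod_cast Int.one_le_abs hm0
    have habs := abs_sub_abs_le_abs_add (m : ℝ) p
    exact .inr (sq_lt_sq.mpr (by linarith))
  simpa using hlim

theorem tendsto_dqTheta_zero (q : ℝ) :
    Tendsto (fun τ : ℍ ↦ dqTheta 0 q τ * cexp (-π * I * τ)) UpperHalfPlane.atImInfty
      (𝓝 (-4 * π * Real.sin (2 * π * q) : ℝ)) := by
  have hlim := tendsto_dqTheta_mul_cexp (p := 0) (μ := 1) q (s := {1, -1}) (by simp) fun m hm ↦ by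
    simp only [Finset.mem_insert, Finset.mem_singleton] at hm
    have hm' : m = 0 ∨ 1 < m ^ 2 := by
      refine or_iff_not_imp_left.mpr fun h0 ↦ one_lt_sq_iff_one_lt_abs m |>.mpr ?_
      grind
    rw [add_zero]
    exact_mod_cast hm'
  rw [Finset.sum_pair (by decide)] at hlim
  convert hlim using 2
  · simp
  · push_cast
    rw [Complex.sin, dqThetaCoeff, dqThetaCoeff]
    push_cast
    ring_nf

theorem tendsto_dqTheta_half (q : ℝ) :
    Tendsto (fun τ : ℍ ↦ dqTheta (1 / 2 : ℝ) q τ * cexp (-π * I * (1 / 4 : ℝ) * τ))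
      UpperHalfPlane.atImInfty (𝓝 (-2 * π * Real.sin (π * q) : ℝ)) := by
  have hlim := tendsto_dqTheta_mul_cexp (p := 1 / 2) (μ := 1 / 4) q (s := {0, -1})
    (by norm_num) fun m hm ↦ by
      simp only [Finset.mem_insert, Finset.mem_singleton] at hm
      have hm' : (0 : ℝ) < m * (m + 1) := by
        norm_cast
        obtain h | h : 0 < m ∨ m < -1 := by omega
        exacts [by positivity, mul_pos_of_neg_of_neg (by omega) (by omega)]
      exact .inr (by linarith)
  rw [Finset.sum_pair (by decide)] at hlim
  convert hlim using 2
  push_cast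
  rw [Complex.sin, dqThetaCoeff, dqThetaCoeff]
  push_cast
  ring_nf

/-- The order of `∂_q ϑ[p,q]` at `i∞`, as a power of `exp (π i τ)`. -/
def cuspExponent (x : Param) : ℝ :=
  open Classical in centeredRep x.1 ^ 2 + if x.1 = 0 then 1 else 0

theorem cuspExponent_of_fst_ne_zero {x : Param} (hx : x.1 ≠ 0) :
    cuspExponent x = centeredRep x.1 ^ 2 := by
  rw [cuspExponent, if_neg hx, add_zero]

theorem sum_cuspExponent {x : Param} (hfin : (paramOrbit x).Finite)
    (h : paramOrbit x ≠ {(half, half)}) :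
    ∑ y ∈ hfin.toFinset, cuspExponent y =
      (paramOrbit x).ncard / 12 + {y | y ∈ paramOrbit x ∧ y.1 = 0}.ncard := by
  classical
  simp only [cuspExponent, Finset.sum_add_distrib, sum_centeredRep_sq hfin h, Finset.sum_boole]
  congr 2
  rw [← Set.ncard_coe_finset]
  congr 1
  ext y
  simp

theorem exists_tendsto_dqTheta_centeredRep {x : Param} (hx : x ∉ paramOrbit (0, 0)) :
    ∃ c : ℂ, c ≠ 0 ∧ Tendsto (fun τ : ℍ ↦ dqTheta (centeredRep x.1) (centeredRep x.2) τ *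
      cexp (-π * I * cuspExponent x * τ)) UpperHalfPlane.atImInfty (𝓝 c) := by
  obtain ⟨a, b⟩ := x
  simp only [paramOrbit_zero_zero, Set.mem_insert_iff, Set.mem_singleton_iff, Prod.mk.injEq,
    not_or, not_and] at hx
  obtain ⟨h00, h10, h01⟩ := hx
  have hb := centeredRep_mem b
  have hb0 (h : b ≠ 0) : centeredRep b ≠ 0 := centeredRep_zero ▸ centeredRep_injective.ne h
  have hpi := Real.pi_pos
  by_cases ha0 : a = 0
  · subst ha0
    have hlt := centeredRep_lt_half (h01 rfl)
    have hsin : Real.sin (2 * π * centeredRep b) ≠ 0 := by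
      rw [Ne, Real.sin_eq_zero_iff_of_lt_of_lt (by nlinarith [hb.1]) (by nlinarith)]
      exact mul_ne_zero Real.two_pi_pos.ne' (hb0 (h00 rfl))
    refine ⟨((-4 * π * Real.sin (2 * π * centeredRep b) : ℝ) : ℂ),
      ofReal_ne_zero.mpr (mul_ne_zero (mul_ne_zero (by norm_num) hpi.ne') hsin), ?_⟩
    simpa only [cuspExponent, centeredRep_zero, if_true, ofReal_zero, ne_eq, OfNat.ofNat_ne_zero,
      not_false_eq_true, zero_pow, zero_add, ofReal_one, mul_one] using
      tendsto_dqTheta_zero (centeredRep b)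
  by_cases ha : a = half
  · subst ha
    have hsin : Real.sin (π * centeredRep b) ≠ 0 := by
      rw [Ne, Real.sin_eq_zero_iff_of_lt_of_lt (by nlinarith [hb.1]) (by nlinarith [hb.2])]
      exact mul_ne_zero hpi.ne' (hb0 (h10 rfl))
    refine ⟨((-2 * π * Real.sin (π * centeredRep b) : ℝ) : ℂ),
      ofReal_ne_zero.mpr (mul_ne_zero (mul_ne_zero (by norm_num) hpi.ne') hsin), ?_⟩
    have hcusp : cuspExponent (half, b) = 1 / 4 := by
      rw [cuspExponent_of_fst_ne_zero ha0, centeredRep_half]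
      norm_num
    simpa only [hcusp, centeredRep_half] using tendsto_dqTheta_half (centeredRep b)
  · have hlt : |centeredRep a| < 1 / 2 := abs_lt.mpr
      ⟨by linarith [(centeredRep_mem a).1], centeredRep_lt_half ha⟩
    refine ⟨_, ?_, cuspExponent_of_fst_ne_zero (x := (a, b)) ha0 ▸
      tendsto_dqTheta_of_abs_lt_half hlt (centeredRep b)⟩
    have ha0' : centeredRep a ≠ 0 := centeredRep_zero ▸ centeredRep_injective.ne ha0
    simp [dqThetaCoeff, ha0', hpi.ne']

theorem exists_tendsto_dqThetaAt {x : Param} (hx : x ∉ paramOrbit (0, 0)) : ∃ c : ℂ, c ≠ 0 ∧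
    Tendsto (fun τ : ℍ ↦ dqThetaAt x τ * cexp (-π * I * cuspExponent x * τ))
      UpperHalfPlane.atImInfty (𝓝 c) := by
  obtain ⟨u, hu, hxu⟩ := exists_dqThetaAt_eq (coe_centeredRep x.1) (coe_centeredRep x.2)
  obtain ⟨c, hc, hlim⟩ := exists_tendsto_dqTheta_centeredRep hx
  refine ⟨u * c, mul_ne_zero hu hc, ?_⟩
  simpa only [hxu, mul_assoc u] using hlim.const_mul u

end Theta

/-! ### The product over an orbit -/

section Product

open Filter Topology UpperHalfPlane ModularForm
open scoped Manifold Real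

theorem tendsto_T_smul_atImInfty :
    Tendsto (fun τ : ℍ ↦ ModularGroup.T • τ) atImInfty atImInfty := by
  refine tendsto_comap_iff.mpr (tendsto_comap.congr fun τ ↦ ?_)
  rw [Function.comp_apply, modular_T_smul, vadd_im]

theorem eq_one_of_T_smul_eq_mul {F : ℍ → ℂ} {u c : ℂ} (hT : ∀ τ, F (ModularGroup.T • τ) = u * F τ)
    (hc : c ≠ 0) (hlim : Tendsto F atImInfty (𝓝 c)) : u = 1 := by
  have huc := tendsto_nhds_unique (hlim.const_mul u)
    ((hlim.comp tendsto_T_smul_atImInfty).congr hT)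
  exact (mul_eq_right₀ hc).mp huc

theorem sq_eq_one_of_S_smul_eq_mul {F : ℍ → ℂ} {v : ℂ} {w : ℤ} (hw : Even w)
    (hS : ∀ τ : ℍ, F (ModularGroup.S • τ) = v * (τ : ℂ) ^ w * F τ) (h0 : F ≠ 0) : v ^ 2 = 1 := by
  obtain ⟨τ, hτ⟩ := Function.ne_iff.mp h0
  have hSS : ModularGroup.S • ModularGroup.S • τ = τ := by
    ext1
    rw [modular_S_smul, modular_S_smul]
    simp
  have h := hS (ModularGroup.S • τ)
  rw [hSS, hS τ, modular_S_smul, coe_mk, inv_zpow, hw.neg_zpow] at h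
  have hτw : (τ : ℂ) ^ w ≠ 0 := zpow_ne_zero _ τ.ne_zero
  simp only [Pi.zero_apply] at hτ
  field_simp at h
  exact h.symm

theorem discriminant_T_smul (τ : ℍ) : discriminant (ModularGroup.T • τ) = discriminant τ := by
  rw [discriminant_smul, denom_T]
  norm_num

theorem exists_coe_eq_sq {G : ℍ → ℂ} {w : ℤ} (hw : Even w) (hG : MDiff G)
    (hT : ∃ u : ℂ, ∀ τ, G (ModularGroup.T • τ) = u * G τ)
    (hS : ∃ v : ℂ, ∀ τ : ℍ, G (ModularGroup.S • τ) = v * (τ : ℂ) ^ w * G τ)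
    {m : ℕ} {c : ℂ} (hc : c ≠ 0)
    (hlim : Tendsto (fun τ ↦ G τ / discriminant τ ^ m) atImInfty (𝓝 c)) :
    ∃ f : ModularForm 𝒮ℒ (2 * w), ⇑f = G ^ 2 := by
  obtain ⟨u, hu⟩ := hT
  obtain ⟨v, hv⟩ := hS
  have hu1 : u = 1 := eq_one_of_T_smul_eq_mul
    (fun τ ↦ by rw [hu, discriminant_T_smul, mul_div_assoc]) hc hlim
  have hv1 : v ^ 2 = 1 :=
    sq_eq_one_of_S_smul_eq_mul hw hv (ne_zero_of_tendsto_div_discriminant_pow hc hlim)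
  have hbdd : Tendsto G atImInfty (𝓝 (c * 0 ^ m)) :=
    (hlim.mul (tendsto_discriminant_atImInfty.pow m)).congr fun τ ↦
      div_mul_cancel₀ _ (pow_ne_zero m (discriminant_ne_zero τ))
  refine ⟨ofLevelOne (G ^ 2) (funext fun τ ↦ ?_) (funext fun τ ↦ ?_) (hG.pow 2)
    ((hbdd.pow 2).isBigO_one ℝ), rfl⟩
  · have hτw : (τ : ℂ) ^ w ≠ 0 := zpow_ne_zero _ τ.ne_zero
    rw [SL_slash_apply, ModularGroup.denom_S, Pi.pow_apply, hv, zpow_neg, two_mul,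
      zpow_add₀ τ.ne_zero, Pi.pow_apply]
    field_simp
    rw [hv1, one_mul]
  · rw [SL_slash_apply, denom_T, one_zpow, mul_one, Pi.pow_apply, hu, hu1, one_mul, Pi.pow_apply]

theorem tendsto_discriminant_mul_cexp :
    Tendsto (fun τ : ℍ ↦ discriminant τ * Complex.exp (-(2 * π * Complex.I * τ)))
      atImInfty (𝓝 1) := by
  refine tendsto_atImInfty_tprod_one_sub_eta_q_pow.congr fun τ ↦ ?_
  rw [discriminant_eq_q_prod, Function.Periodic.qParam, mul_right_comm, Complex.ofReal_one,
    div_one, ← Complex.exp_add, add_neg_cancel, Complex.exp_zero, one_mul]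

theorem mdifferentiable_dqThetaAt (x : Param) : MDiff (fun τ : ℍ ↦ dqThetaAt x τ) :=
  fun τ ↦ (analyticAt_dqThetaAt x τ).differentiableAt.mdifferentiableAt.comp τ
    (mdifferentiable_coe τ)

theorem ord_dqThetaAt (x : Param) : ord (fun τ : ℍ ↦ dqThetaAt x τ) = zeroOrder x :=
  funext fun τ ↦ ord_comp_coe (dqThetaAt x) τ

theorem zeroOrder_ne_top {x : Param} (hx : x ∉ paramOrbit (0, 0)) (τ : ℍ) :
    zeroOrder x τ ≠ ⊤ := by
  obtain ⟨c, hc, hlim⟩ := exists_tendsto_dqThetaAt hx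
  rw [← ord_dqThetaAt]
  refine ord_ne_top (mdifferentiable_dqThetaAt x) (fun h0 ↦ hc ?_) τ
  have hzero (τ : ℍ) : dqThetaAt x τ = 0 := congrFun h0 τ
  simp only [hzero, zero_mul] at hlim
  exact tendsto_nhds_unique hlim tendsto_const_nhds

variable {x : Param} (hfin : (paramOrbit x).Finite)

/-- The product of the functions `∂_q ϑ[p',q']` over a finite orbit. -/
def orbitProduct (τ : ℍ) : ℂ := ∏ y ∈ hfin.toFinset, dqThetaAt y τ

theorem orbitProduct_eq_prod :
    orbitProduct hfin = ∏ y ∈ hfin.toFinset, fun τ : ℍ ↦ dqThetaAt y τ := by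
  ext τ
  rw [orbitProduct, Finset.prod_apply]

theorem mdifferentiable_orbitProduct : MDiff (orbitProduct hfin) := by
  rw [orbitProduct_eq_prod]
  exact MDifferentiable.prod fun y _ ↦ mdifferentiable_dqThetaAt y

theorem ord_orbitProduct (τ : ℍ) :
    ord (orbitProduct hfin) τ = ∑ y ∈ hfin.toFinset, zeroOrder y τ := by
  rw [orbitProduct_eq_prod, ord_prod fun y _ ↦ mdifferentiable_dqThetaAt y]
  simp only [ord_dqThetaAt]

theorem exists_orbitProduct_T_smul :
    ∃ u : ℂ, ∀ τ, orbitProduct hfin (ModularGroup.T • τ) = u * orbitProduct hfin τ := by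
  choose u hu using exists_dqThetaAt_add_one
  refine ⟨∏ y ∈ hfin.toFinset, u y, fun τ ↦ ?_⟩
  rw [orbitProduct, orbitProduct, ← prod_paramOrbit_permT hfin fun y ↦ dqThetaAt y τ,
    ← Finset.prod_mul_distrib]
  refine Finset.prod_congr rfl fun y _ ↦ ?_
  rw [modular_T_smul, coe_vadd, Complex.ofReal_one, add_comm, hu]

theorem exists_orbitProduct_S_smul :
    ∃ v : ℂ, ∀ τ : ℍ, orbitProduct hfin (ModularGroup.S • τ) =
      v * (τ * (-Complex.I * τ) ^ (1 / 2 : ℂ)) ^ (paramOrbit x).ncard * orbitProduct hfin τ := by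
  choose v hv using exists_dqThetaAt_permS_neg_inv
  refine ⟨∏ y ∈ hfin.toFinset, v y, fun τ ↦ ?_⟩
  rw [orbitProduct, orbitProduct, Set.ncard_eq_toFinset_card _ hfin, ← Finset.prod_const,
    ← Finset.prod_mul_distrib, ← Finset.prod_mul_distrib,
    ← prod_paramOrbit_permS hfin fun y ↦ dqThetaAt y (ModularGroup.S • τ : ℍ)]
  refine Finset.prod_congr rfl fun y _ ↦ ?_
  rw [← hv y τ τ.im_pos, modular_S_smul, coe_mk, inv_neg, neg_div, one_div]

theorem neg_I_mul_cpow_half_pow (τ : ℂ) :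
    (τ * (-Complex.I * τ) ^ (1 / 2 : ℂ)) ^ 24 = τ ^ 36 := by
  have hI : (-Complex.I) ^ 12 = 1 := by
    rw [neg_pow, Complex.I_pow_eq_pow_mod]
    norm_num
  rw [mul_pow, ← Complex.cpow_nat_mul, show ((24 : ℕ) : ℂ) * (1 / 2) = (12 : ℕ) by norm_num,
    Complex.cpow_natCast, mul_pow, hI, one_mul, ← pow_add]

theorem exists_tendsto_orbitProduct (h : paramOrbit x ≠ {(0, 0), (half, 0), (0, half)}) :
    ∃ c : ℂ, c ≠ 0 ∧ Tendsto (fun τ : ℍ ↦ orbitProduct hfin τ *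
      Complex.exp (-π * Complex.I * (∑ y ∈ hfin.toFinset, cuspExponent y : ℝ) * τ))
      atImInfty (𝓝 c) := by
  choose! c hc hlim using fun y (hy : y ∉ paramOrbit (0, 0)) ↦ exists_tendsto_dqThetaAt hy
  have hmem {y : Param} (hy : y ∈ hfin.toFinset) : y ∉ paramOrbit (0, 0) :=
    notMem_paramOrbit_zero_zero h (hfin.mem_toFinset.mp hy)
  refine ⟨∏ y ∈ hfin.toFinset, c y, Finset.prod_ne_zero_iff.mpr fun y hy ↦ hc y (hmem hy),
    (tendsto_finsetProd _ fun y hy ↦ hlim y (hmem hy)).congr fun τ ↦ ?_⟩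
  rw [orbitProduct, Finset.prod_mul_distrib, ← Complex.exp_sum, Complex.ofReal_sum,
    Finset.mul_sum, Finset.sum_mul]

theorem exists_tendsto_orbitProduct_pow_div (h₁ : paramOrbit x ≠ {(half, half)})
    (h₂ : paramOrbit x ≠ {(0, 0), (half, 0), (0, half)}) :
    ∃ c : ℂ, c ≠ 0 ∧ Tendsto (fun τ : ℍ ↦ orbitProduct hfin τ ^ 24 / discriminant τ ^
      ((paramOrbit x).ncard + 12 * {y | y ∈ paramOrbit x ∧ y.1 = 0}.ncard)) atImInfty (𝓝 c) := by
  set K := (paramOrbit x).ncard + 12 * {y | y ∈ paramOrbit x ∧ y.1 = 0}.ncard with hK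
  obtain ⟨c, hc, hlim⟩ := exists_tendsto_orbitProduct hfin h₂
  have hdiv := (hlim.pow 24).div (tendsto_discriminant_mul_cexp.pow K) (by simp)
  refine ⟨c ^ 24, pow_ne_zero 24 hc, ?_⟩
  rw [one_pow, div_one] at hdiv
  refine hdiv.congr fun τ ↦ ?_
  have hexp : Complex.exp (-π * Complex.I * (∑ y ∈ hfin.toFinset, cuspExponent y : ℝ) * τ) ^ 24 =
      Complex.exp (-(2 * π * Complex.I * τ)) ^ K := by
    rw [← Complex.exp_nat_mul, ← Complex.exp_nat_mul, sum_cuspExponent hfin h₁, hK]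
    push_cast
    ring_nf
  rw [Pi.div_apply, mul_pow, mul_pow, hexp,
    mul_div_mul_right _ _ (pow_ne_zero _ (Complex.exp_ne_zero _))]

theorem exists_coe_eq_orbitProduct_pow (h₁ : paramOrbit x ≠ {(half, half)})
    (h₂ : paramOrbit x ≠ {(0, 0), (half, 0), (0, half)}) :
    ∃ f : ModularForm 𝒮ℒ (72 * (paramOrbit x).ncard), ⇑f = orbitProduct hfin ^ 48 := by
  obtain ⟨c, hc, hlim⟩ := exists_tendsto_orbitProduct_pow_div hfin h₁ h₂
  obtain ⟨u, hu⟩ := exists_orbitProduct_T_smul hfin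
  obtain ⟨v, hv⟩ := exists_orbitProduct_S_smul hfin
  obtain ⟨f, hf⟩ := exists_coe_eq_sq (G := orbitProduct hfin ^ 24)
    (w := 36 * (paramOrbit x).ncard) ((by decide : Even (36 : ℤ)).mul_right _)
    ((mdifferentiable_orbitProduct hfin).pow 24)
    ⟨u ^ 24, fun τ ↦ by rw [Pi.pow_apply, hu, mul_pow, Pi.pow_apply]⟩
    ⟨v ^ 24, fun τ ↦ by
      rw [Pi.pow_apply, hv, mul_pow, mul_pow, pow_right_comm, neg_I_mul_cpow_half_pow, ← pow_mul,
        Pi.pow_apply]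
      norm_cast⟩ hc hlim
  exact ⟨f.mcast (by ring), by rw [pow_mul _ 24 2, ← hf]; rfl⟩

theorem finite_zeros_and_sum_orbifoldDegree_zeroOrder (h₁ : paramOrbit x ≠ {(half, half)})
    (h₂ : paramOrbit x ≠ {(0, 0), (half, 0), (0, half)}) {R : Set ℍ} (hR : IsFundamentalSet R) :
    (∀ y ∈ paramOrbit x, {P | P ∈ R ∧ zeroOrder y P ≠ 0}.Finite) ∧
      ∑ y ∈ hfin.toFinset, orbifoldDegree R (zeroOrder y) =
        (paramOrbit x).ncard / 12 - {y | y ∈ paramOrbit x ∧ y.1 = 0}.ncard / 2 := by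
  obtain ⟨c, hc, hlim⟩ := exists_tendsto_orbitProduct_pow_div hfin h₁ h₂
  obtain ⟨f, hf⟩ := exists_coe_eq_orbitProduct_pow hfin h₁ h₂
  have hord : ord f = fun τ ↦ ((48 : ℕ) : ℕ∞) * ∑ y ∈ hfin.toFinset, zeroOrder y τ := by
    ext1 τ
    rw [hf, ord_pow (mdifferentiable_orbitProduct hfin), ord_orbitProduct]
  obtain ⟨hzeros, hdegree⟩ := valence_formula f (pow_ne_zero 2 hc) ((hlim.pow 2).congr fun τ ↦ by
    rw [hf, Pi.pow_apply, div_pow, ← pow_mul, ← pow_mul]) hR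
  have hfinite : ∀ y ∈ hfin.toFinset, {P | P ∈ R ∧ zeroOrder y P ≠ 0}.Finite := fun y hy ↦ by
    refine hzeros.subset fun P ⟨hPR, hP⟩ ↦ ⟨hPR, ?_⟩
    rw [hord]
    exact mul_ne_zero (by norm_num) fun h ↦ hP (Finset.sum_eq_zero_iff.mp h y hy)
  refine ⟨fun y hy ↦ hfinite y (hfin.mem_toFinset.mpr hy), ?_⟩
  rw [hord, orbifoldDegree_nat_mul, orbifoldDegree_sum (fun y hy ↦ zeroOrder_ne_top
    (notMem_paramOrbit_zero_zero h₂ (hfin.mem_toFinset.mp hy))) hfinite] at hdegree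
  push_cast at hdegree
  linarith

end Product

end BianchiIX

end

theorem mainTheorem12 (p q : ℝ)
    (hfin : (BianchiIX.paramOrbit ((p : UnitAddCircle), (q : UnitAddCircle))).Finite)
    (h₁ : BianchiIX.paramOrbit ((p : UnitAddCircle), (q : UnitAddCircle)) ≠
      {(BianchiIX.half, BianchiIX.half)})
    (h₂ : BianchiIX.paramOrbit ((p : UnitAddCircle), (q : UnitAddCircle)) ≠
      {(0, 0), (BianchiIX.half, 0), (0, BianchiIX.half)}) :
    Even (BianchiIX.paramOrbit ((p : UnitAddCircle), (q : UnitAddCircle))).ncard ∧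
    (∀ x ∈ BianchiIX.paramOrbit ((p : UnitAddCircle), (q : UnitAddCircle)),
      ∀ τ : UpperHalfPlane,
        AnalyticAt ℂ (BianchiIX.dqThetaAt x) (τ : ℂ) ∧ BianchiIX.zeroOrder x τ ≠ ⊤) ∧
    ∀ R : Set UpperHalfPlane, BianchiIX.IsFundamentalSet R →
      (∀ x ∈ BianchiIX.paramOrbit ((p : UnitAddCircle), (q : UnitAddCircle)),
        {P | P ∈ R ∧ BianchiIX.zeroOrder x P ≠ 0}.Finite) ∧
      ∑ x ∈ hfin.toFinset,
        ((1 / 2 : ℚ) * ((BianchiIX.zeroOrder x UpperHalfPlane.I).toNat : ℚ) +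
          (1 / 3 : ℚ) * ((BianchiIX.zeroOrder x UpperHalfPlane.ρ).toNat : ℚ) +
          ∑ᶠ P ∈ BianchiIX.nonElliptic R, ((BianchiIX.zeroOrder x P).toNat : ℚ)) =
      ((BianchiIX.paramOrbit ((p : UnitAddCircle), (q : UnitAddCircle))).ncard : ℚ) / 12 -
        ({x | x ∈ BianchiIX.paramOrbit ((p : UnitAddCircle), (q : UnitAddCircle)) ∧
          x.1 = 0}.ncard : ℚ) / 2 :=
  ⟨BianchiIX.even_ncard_paramOrbit hfin h₁ h₂,
    fun x hx τ ↦ ⟨BianchiIX.analyticAt_dqThetaAt x τ,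
      BianchiIX.zeroOrder_ne_top (BianchiIX.notMem_paramOrbit_zero_zero h₂ hx) τ⟩,
    fun _ hR ↦ BianchiIX.finite_zeros_and_sum_orbifoldDegree_zeroOrder hfin h₁ h₂ hR⟩
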